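/- Let $p\ge 5$ be a prime and $\chi$ the $p$-adic cyclotomic character of $G_{\mathbb Q}=\mathrm{Gal}(\overline{\mathbb Q}/\mathbb Q)$, with reduction $\bar\chi$ mod $p$. Let $\beta:G_{\mathbb Q}\to\mathbb F_p^\times$ be a continuous character, $\bar\rho=\begin{pmatrix}\bar\chi\beta^2&*\\0&1\end{pmatrix}:G_{\mathbb Q}\to \mathrm{GL}_2(\mathbb F_p)$ a continuous representation, and $\rho:G_{\mathbb Q}\to\mathrm{GL}_2(\mathbb Z_p)$ a continuous lift of $\bar\rho$. Let $\tilde\beta$ be the Teichmüller lift of $\beta$, $\psi=\tilde\beta^{-1}$, and let $V=\mathbb Q_p e_1\oplus\mathbb Q_p e_2$ be the space on which $G_{\mathbb Q}$ acts through $\rho\otimes\psi$. Put $T=\mathbb Z_pe_1\oplus\mathbb Z_pe_2$ and $T'=\mathbb Z_p\,p^{-1}e_1\oplus\mathbb Z_pe_2$ (both are Galois stable), $A=V/T$ and $A'=V/T'$. Let $\ell$ be a prime and fix an embedding $\overline{\mathbb Q}\hookrightarrow\overline{\mathbb Q}_\ell$, with the resulting map $G_\ell=\mathrm{Gal}(\overline{\mathbb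 Q}_\ell/\mathbb Q_\ell)\to G_{\mathbb Q}$, along which we restrict representations to $G_\ell$. Let $\sigma_\ell\in G_\ell$ be a Frobenius element and $\tau_\ell\in I_\ell$ an element of inertia whose image topologically generates the maximal pro-$p$ quotient of $I_\ell$. Suppose that $\ell$ is a *trivial prime*, i.e. $\ell\equiv1\bmod p$, $\ell\not\equiv1\bmod p^2$ and $\bar\rho|_{G_\ell}$ is trivial, and that $\rho|_{G_\ell}$ satisfies the *Type II condition*: there are $C\in\mathrm{GL}_2(\mathbb Z_p)$ with $C\equiv 1\bmod p$ and $x,y\in\mathbb Z_p$ with $p^2\mid x$, $p\mid y$ and $p^2\nmid y$, such that $$C\rho(\sigma_\ell)C^{-1}=\begin{pmatrix}1&0\\x&\ell\end{pmatrix},\qquad C\rho(\tau_\ell)C^{-1}=\begin{pmatrix}1&0\\y&1\end{pmatrix}.$$ For $B=V/T_B$ with $T_B\in\{T,T'\}$, let $H^1_{nr}(L,M)$ denote the kernel of the restriction of $H^1(L,M)$ (continuous cohomology) to inertia, and let $H^1_f(\mathbb Q_\ell,B)$ be the image of $H^1_{nr}(\mathbb Q_\ell,V)$ in $H^1(\mathbb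 Q_\ell,B)$. Put $\mathcal J^{BK}_\ell(B/\mathbb Q)=H^1(\mathbb Q_\ell,B)/H^1_f(\mathbb Q_\ell,B)$ and $$\mathcal J^{Gr}_\ell(B/\mathbb Q_\infty)=\varinjlim_n\bigoplus_{v\mid\ell}H^1(\mathbb Q_{n,v},B)/H^1_{nr}(\mathbb Q_{n,v},B),$$ where $\mathbb Q_n$ is the $n$-th layer of the cyclotomic $\mathbb Z_p$-extension $\mathbb Q_\infty$ of $\mathbb Q$ and $v$ runs over the primes of $\mathbb Q_n$ above $\ell$. Let $h_{\ell,B}:\mathcal J^{BK}_\ell(B/\mathbb Q)\to\mathcal J^{Gr}_\ell(B/\mathbb Q_\infty)^{\mathrm{Gal}(\mathbb Q_\infty/\mathbb Q)}$ be the restriction map, and $\delta_\ell(B)=\dim_{\mathbb F_p}(\ker h_{\ell,B})[p]$. Then $\delta_\ell(A')=0$. If moreover $\beta|_{G_\ell}=1$, then $\delta_\ell(A)=1$. -/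

import Mathlib

open scoped Matrix

noncomputable section

namespace TypeTwo

/-! ### Continuous cohomology in degree one -/

section Cohomology

variable {k : Type} [CommRing k]
variable {G : Type} [Group G] [TopologicalSpace G]
variable {G' : Type} [Group G'] [TopologicalSpace G']
variable {M : Type} [AddCommGroup M] [Module k M] [TopologicalSpace M] [IsTopologicalAddGroup M]
variable {M' : Type} [AddCommGroup M'] [Module k M'] [TopologicalSpace M']
  [IsTopologicalAddGroup M']

/-- Continuous 1-cocycles (crossed homomorphisms) `z : G → M`, `z (g h) = z g + g • z h`. -/
def Z1 (φ : Representation k G M) : AddSubgroup (G → M) where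
  carrier := {z | Continuous z ∧ ∀ g h, z (g * h) = z g + φ g (z h)}
  zero_mem' := ⟨continuous_const, fun g h => by simp⟩
  add_mem' := by
    rintro a b ⟨ha, ha'⟩ ⟨hb, hb'⟩
    refine ⟨ha.add hb, fun g h => ?_⟩
    simp only [Pi.add_apply, ha', hb', map_add]
    abel
  neg_mem' := by
    rintro a ⟨ha, ha'⟩
    refine ⟨ha.neg, fun g h => ?_⟩
    simp only [Pi.neg_apply, ha', map_neg]
    abel

/-- The 1-coboundaries `g ↦ g • x - x` among the continuous 1-cocycles. -/
def B1 (φ : Representation k G M) : AddSubgroup (Z1 φ) where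
  carrier := {z | ∃ x : M, ∀ g, z.1 g = φ g x - x}
  zero_mem' := ⟨0, fun g => by simp⟩
  add_mem' := by
    rintro a b ⟨x, hx⟩ ⟨y, hy⟩
    refine ⟨x + y, fun g => ?_⟩
    simp only [AddSubgroup.coe_add, Pi.add_apply, hx, hy, map_add]
    abel
  neg_mem' := by
    rintro a ⟨x, hx⟩
    refine ⟨-x, fun g => ?_⟩
    simp only [AddSubgroup.coe_neg, Pi.neg_apply, hx, map_neg]
    abel

/-- `H¹(G, M)`: continuous crossed homomorphisms modulo principal ones. -/
abbrev H1 (φ : Representation k G M) : Type := Z1 φ ⧸ B1 φ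

/-- Pull-back of cocycles along a continuous homomorphism `f : G' → G` and push-forward along a
continuous linear map `m : M → M'` that is compatible with the actions. -/
def Z1.map {φ : Representation k G M} {φ' : Representation k G' M'}
    (f : G' →* G) (hf : Continuous f) (m : M →ₗ[k] M') (hm : Continuous m)
    (h : ∀ g x, m (φ (f g) x) = φ' g (m x)) : Z1 φ →+ Z1 φ' where
  toFun z := ⟨fun g => m (z.1 (f g)), hm.comp (z.2.1.comp hf), fun a b => by
    simp only [map_mul, z.2.2, map_add, h]⟩
  map_zero' := by ext; simp
  map_add' a b := by ext; simp

/-- The map induced on `H¹` by a compatible pair `(f, m)`. -/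
def H1.map {φ : Representation k G M} {φ' : Representation k G' M'}
    (f : G' →* G) (hf : Continuous f) (m : M →ₗ[k] M') (hm : Continuous m)
    (h : ∀ g x, m (φ (f g) x) = φ' g (m x)) : H1 φ →+ H1 φ' :=
  QuotientAddGroup.map (B1 φ) (B1 φ') (Z1.map f hf m hm h) (by
    rintro z ⟨x, hx⟩
    exact ⟨m x, fun g => by simp [Z1.map, hx, h]⟩)

/-- The class of a cocycle. -/
def H1.mk (φ : Representation k G M) : Z1 φ →+ H1 φ := QuotientAddGroup.mk' (B1 φ)

lemma H1.mk_surjective (φ : Representation k G M) : Function.Surjective (H1.mk φ) :=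
  QuotientAddGroup.mk'_surjective _

lemma H1.mk_eq_zero {φ : Representation k G M} {z : Z1 φ} :
    H1.mk φ z = 0 ↔ ∃ x : M, ∀ g, z.1 g = φ g x - x :=
  QuotientAddGroup.eq_zero_iff z

lemma H1.map_mk {φ : Representation k G M} {φ' : Representation k G' M'}
    (f : G' →* G) (hf : Continuous f) (m : M →ₗ[k] M') (hm : Continuous m)
    (h : ∀ g x, m (φ (f g) x) = φ' g (m x)) (z : Z1 φ) :
    H1.map f hf m hm h (H1.mk φ z) = H1.mk φ' (Z1.map f hf m hm h z) := rfl

lemma Z1.map_apply {φ : Representation k G M} {φ' : Representation k G' M'}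
    (f : G' →* G) (hf : Continuous f) (m : M →ₗ[k] M') (hm : Continuous m)
    (h : ∀ g x, m (φ (f g) x) = φ' g (m x)) (z : Z1 φ) (g : G') :
    (Z1.map f hf m hm h z).1 g = m (z.1 (f g)) := rfl

end Cohomology

/-! ### Galois groups -/

/-- The chosen algebraic closure of `ℚ`. -/
abbrev Qbar : Type := AlgebraicClosure ℚ

instance : IsAlgClosure ℚ Qbar := by
  have h : @IsAlgClosure ℚ Qbar _ _ (AlgebraicClosure.instAlgebra ℚ) _ := inferInstance
  convert h
  exact Subsingleton.elim _ _

/-- The absolute Galois group of `ℚ`, with its Krull topology. -/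
abbrev GQ : Type := Gal(Qbar/ℚ)

/-- The absolute Galois group of `ℚ_ℓ`, with its Krull topology. -/
abbrev GLoc (ℓ : ℕ) [Fact ℓ.Prime] : Type := Gal(PadicAlgCl ℓ/ℚ_[ℓ])

section Local

variable {ℓ : ℕ} [Fact ℓ.Prime]

lemma norm_gal (s : GLoc ℓ) (x : PadicAlgCl ℓ) : ‖s x‖ = ‖x‖ := by
  rw [← PadicAlgCl.spectralNorm_eq, ← PadicAlgCl.spectralNorm_eq]
  exact (spectralNorm_eq_of_equiv s x).symm

/-- The inertia subgroup of `Gal(ℚ̄_ℓ/ℚ_ℓ)`: the elements that act trivially on the residue field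
of the valuation ring `{‖x‖ ≤ 1}` of `ℚ̄_ℓ`. -/
def inertia (ℓ : ℕ) [Fact ℓ.Prime] : Subgroup (GLoc ℓ) where
  carrier := {s | ∀ x : PadicAlgCl ℓ, ‖x‖ ≤ 1 → ‖s x - x‖ < 1}
  one_mem' := fun x _ => by simp
  mul_mem' := by
    intro a b ha hb x hx
    have h1 := ha (b x) ((norm_gal b x).trans_le hx)
    have h2 := hb x hx
    have : (a * b) x - x = (a (b x) - b x) + (b x - x) := by
      rw [AlgEquiv.mul_apply]; ring
    rw [this]
    exact (IsUltrametricDist.norm_add_le_max _ _).trans_lt (max_lt h1 h2)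
  inv_mem' := by
    intro a ha x hx
    have h := ha (a⁻¹ x) ((norm_gal a⁻¹ x).trans_le hx)
    have h2 : a (a⁻¹ x) = x := by
      rw [← AlgEquiv.mul_apply, mul_inv_cancel, AlgEquiv.one_apply]
    rwa [h2, norm_sub_rev] at h

lemma conj_mem_inertia (t : GLoc ℓ) {s : GLoc ℓ} (hs : s ∈ inertia ℓ) :
    t⁻¹ * s * t ∈ inertia ℓ := by
  intro x hx
  have h := hs (t x) ((norm_gal t x).trans_le hx)
  have h2 : t ((t⁻¹ * s * t) x - x) = s (t x) - t x := by
    rw [map_sub, ← AlgEquiv.mul_apply, mul_assoc, mul_inv_cancel_left, AlgEquiv.mul_apply]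
  rw [← norm_gal t, h2]
  exact h

/-- `σ` is an (arithmetic) Frobenius element: it acts as `x ↦ x ^ ℓ` on the residue field. -/
def IsFrobenius (σ : GLoc ℓ) : Prop :=
  ∀ x : PadicAlgCl ℓ, ‖x‖ ≤ 1 → ‖σ x - x ^ ℓ‖ < 1

/-- `τ` lies in the inertia group and its image topologically generates the maximal pro-`p`
quotient of inertia (for `ℓ ≠ p` this is the pro-`p` quotient of tame inertia). -/
def IsTameGenerator (p : ℕ) (τ : inertia ℓ) : Prop :=
  ∀ N : Subgroup (inertia ℓ), N.Normal → IsOpen (N : Set (inertia ℓ)) →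
    (∃ k : ℕ, N.index = p ^ k) → Subgroup.zpowers τ ⊔ N = ⊤

/-- The homomorphism `Gal(ℚ̄_ℓ/ℚ_ℓ) → Gal(ℚ̄/ℚ)` induced by an embedding `ι : ℚ̄ → ℚ̄_ℓ`,
characterised by `ι (res ι s x) = s (ι x)`. -/
def res (ι : Qbar →ₐ[ℚ] PadicAlgCl ℓ) : GLoc ℓ →* GQ :=
  letI : Algebra Qbar (PadicAlgCl ℓ) := ι.toRingHom.toAlgebra
  haveI : IsScalarTower ℚ Qbar (PadicAlgCl ℓ) := IsScalarTower.of_algebraMap_eq' (Subsingleton.elim _ _)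
  (AlgEquiv.restrictNormalHom (F := ℚ) (K₁ := PadicAlgCl ℓ) Qbar).comp
    (AlgEquiv.restrictScalarsHom ℚ)

lemma res_spec (ι : Qbar →ₐ[ℚ] PadicAlgCl ℓ) (s : GLoc ℓ) (x : Qbar) :
    ι (res ι s x) = s (ι x) := by
  let _ : Algebra Qbar (PadicAlgCl ℓ) := ι.toRingHom.toAlgebra
  have : IsScalarTower ℚ Qbar (PadicAlgCl ℓ) := IsScalarTower.of_algebraMap_eq' (Subsingleton.elim _ _)
  exact AlgEquiv.restrictNormal_commutes (s.restrictScalars ℚ) Qbar x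

end Local

/-! ### The cyclotomic `ℤ_p`-extension -/

section Cyclotomic

variable (p : ℕ) [Fact p.Prime]

/-- The `p`-adic cyclotomic character. -/
def chi : GQ →* ℤ_[p]ˣ :=
  (cyclotomicCharacter Qbar p).comp (MulSemiringAction.toRingAut GQ Qbar)

/-- The elements `g` with `χ(g) ^ (p - 1) ≡ 1 mod p ^ (n + 1)`. -/
def layerSubgroup (n : ℕ) : Subgroup GQ :=
  ((powMonoidHom (p - 1)).comp
    ((Units.map (PadicInt.toZModPow (p := p) (n + 1)).toMonoidHom).comp (chi p))).ker

/-- The `n`-th layer `ℚ_n` of the cyclotomic `ℤ_p`-extension of `ℚ` (for odd `p`): the subfield of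
`ℚ(μ_{p ^ (n + 1)})` fixed by the subgroup of order `p - 1` of `(ℤ / p ^ (n + 1))ˣ`; it is the
unique subfield of degree `p ^ n` over `ℚ` of the cyclotomic `ℤ_p`-extension. -/
def layer (n : ℕ) : IntermediateField ℚ Qbar := IntermediateField.fixedField (layerSubgroup p n)

lemma layerSubgroup_anti {n m : ℕ} (h : n ≤ m) : layerSubgroup p m ≤ layerSubgroup p n := by
  intro g hg
  simp only [layerSubgroup, MonoidHom.mem_ker, MonoidHom.comp_apply, powMonoidHom_apply,
    ← map_pow, Units.ext_iff, Units.coe_map, Units.val_one] at hg ⊢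
  change PadicInt.toZModPow (n + 1) ((chi p (g ^ (p - 1)) : ℤ_[p]ˣ) : ℤ_[p]) = 1
  change PadicInt.toZModPow (m + 1) ((chi p (g ^ (p - 1)) : ℤ_[p]ˣ) : ℤ_[p]) = 1 at hg
  rw [← PadicInt.cast_toZModPow (n + 1) (m + 1) (by omega), hg]
  exact ZMod.cast_one (pow_dvd_pow p (by omega))

lemma layer_mono {n m : ℕ} (h : n ≤ m) : layer p n ≤ layer p m := by
  intro x hx
  rw [layer, IntermediateField.mem_fixedField_iff] at hx ⊢
  exact fun g hg => hx g (layerSubgroup_anti p h hg)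

end Cyclotomic

/-! ### Lattices and the local cohomology groups -/

/-- The space `V = ℚ_p²`. -/
abbrev Vsp (p : ℕ) [Fact p.Prime] : Type := Fin 2 → ℚ_[p]

/-- A two-dimensional `p`-adic representation of `Gal(ℚ̄/ℚ)` on `V = ℚ_p²` with a Galois stable
`ℤ_p`-submodule `T` (a lattice, in the cases used). -/
structure GaloisLattice (p : ℕ) [Fact p.Prime] where
  rep : Representation ℚ_[p] GQ (Vsp p)
  lattice : Submodule ℤ_[p] (Vsp p)
  stable : ∀ g, ∀ v ∈ lattice, rep g v ∈ lattice

section Delta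

variable {p : ℕ} [Fact p.Prime] {ℓ : ℕ} [Fact ℓ.Prime]

namespace GaloisLattice

variable (Λ : GaloisLattice p)

/-- The action on `V`, regarded as `ℤ_p`-linear. -/
def repV : Representation ℤ_[p] GQ (Vsp p) where
  toFun g := (Λ.rep g).restrictScalars ℤ_[p]
  map_one' := by ext; simp
  map_mul' a b := by ext; simp

/-- `A = V / T`, with the quotient topology. -/
abbrev A : Type := Vsp p ⧸ Λ.lattice

/-- The action on `A = V / T`. -/
def repA : Representation ℤ_[p] GQ Λ.A := Λ.repV.quotient Λ.lattice Λ.stable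

lemma continuous_repV (g : GQ) : Continuous (Λ.repV g) :=
  LinearMap.continuous_of_finiteDimensional (Λ.rep g)

lemma continuous_mkQ : Continuous Λ.lattice.mkQ := continuous_quot_mk

lemma continuous_repA (g : GQ) : Continuous (Λ.repA g) :=
  continuous_quot_lift _ (continuous_quot_mk.comp (Λ.continuous_repV g))

end GaloisLattice

section LocalCohomology

variable {M : Type} [AddCommGroup M] [Module ℤ_[p] M] [TopologicalSpace M]
  [IsTopologicalAddGroup M]

/-- The action of `Gal(ℚ̄_ℓ/ℚ_ℓ)` on a `Gal(ℚ̄/ℚ)`-module through the embedding `ι ∘ g` of `ℚ̄`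
into `ℚ̄_ℓ`: the element `s` acts as `g⁻¹ (res ι s) g`. -/
def localRep (ι : Qbar →ₐ[ℚ] PadicAlgCl ℓ) (g : GQ) (φ : Representation ℤ_[p] GQ M) :
    Representation ℤ_[p] (GLoc ℓ) M :=
  φ.comp ((MulAut.conj g⁻¹).toMonoidHom.comp (res ι))

lemma localRep_apply (ι : Qbar →ₐ[ℚ] PadicAlgCl ℓ) (g : GQ) (φ : Representation ℤ_[p] GQ M)
    (s : GLoc ℓ) : localRep ι g φ s = φ (g⁻¹ * res ι s * g) := by
  simp [localRep]

/-- `H¹(U, M)` for a subgroup `U` of `Gal(ℚ̄_ℓ/ℚ_ℓ)`. -/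
abbrev H1On (θ : Representation ℤ_[p] (GLoc ℓ) M) (U : Subgroup (GLoc ℓ)) : Type :=
  H1 (θ.comp U.subtype)

lemma continuous_inclusion {U U' : Subgroup (GLoc ℓ)} (h : U' ≤ U) :
    Continuous (Subgroup.inclusion h) :=
  continuous_subtype_val.subtype_mk _

lemma resOn_compat (θ : Representation ℤ_[p] (GLoc ℓ) M) {U U' : Subgroup (GLoc ℓ)} (h : U' ≤ U)
    (s : U') (x : M) : (LinearMap.id : M →ₗ[ℤ_[p]] M)
      ((θ.comp U.subtype) (Subgroup.inclusion h s) x) =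
      (θ.comp U'.subtype) s ((LinearMap.id : M →ₗ[ℤ_[p]] M) x) :=
  rfl

lemma continuous_linearMap_id : Continuous (LinearMap.id : M →ₗ[ℤ_[p]] M) := continuous_id

/-- Restriction to a smaller subgroup. -/
def resOn (θ : Representation ℤ_[p] (GLoc ℓ) M) {U U' : Subgroup (GLoc ℓ)} (h : U' ≤ U) :
    H1On θ U →+ H1On θ U' :=
  H1.map (Subgroup.inclusion h) (continuous_inclusion h) LinearMap.id continuous_linearMap_id
    (resOn_compat θ h)

/-- `H¹(L, M)` for an algebraic extension `L ⊆ ℚ̄_ℓ` of `ℚ_ℓ`. -/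
abbrev H1Field (θ : Representation ℤ_[p] (GLoc ℓ) M)
    (L : IntermediateField ℚ_[ℓ] (PadicAlgCl ℓ)) : Type :=
  H1On θ L.fixingSubgroup

/-- `H¹_nr(L, M)`: the kernel of restriction to the inertia group of `L`. -/
def H1nr (θ : Representation ℤ_[p] (GLoc ℓ) M)
    (L : IntermediateField ℚ_[ℓ] (PadicAlgCl ℓ)) : AddSubgroup (H1Field θ L) :=
  (resOn θ (inf_le_left : L.fixingSubgroup ⊓ inertia ℓ ≤ L.fixingSubgroup)).ker

lemma mem_H1nr_mk {θ : Representation ℤ_[p] (GLoc ℓ) M}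
    {L : IntermediateField ℚ_[ℓ] (PadicAlgCl ℓ)} {z : Z1 (θ.comp L.fixingSubgroup.subtype)} :
    H1.mk _ z ∈ H1nr θ L ↔
      ∃ x : M, ∀ (s : GLoc ℓ) (hs : s ∈ L.fixingSubgroup), s ∈ inertia ℓ →
        z.1 ⟨s, hs⟩ = θ s x - x := by
  rw [H1nr, AddMonoidHom.mem_ker, resOn, H1.map_mk, H1.mk_eq_zero]
  constructor
  · rintro ⟨x, hx⟩
    exact ⟨x, fun s hs hi => hx ⟨s, hs, hi⟩⟩
  · rintro ⟨x, hx⟩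
    exact ⟨x, fun s => hx s.1 s.2.1 s.2.2⟩

/-- For a subfield `K` of `ℚ̄`, the field `ℚ_ℓ · ι(g(K)) ⊆ ℚ̄_ℓ`. When `K` is a number field, this
is the completion `K_v` of `K` at the prime `v ∣ ℓ` induced by the embedding `ι ∘ g`. -/
def locField (ι : Qbar →ₐ[ℚ] PadicAlgCl ℓ) (K : IntermediateField ℚ Qbar) (g : GQ) :
    IntermediateField ℚ_[ℓ] (PadicAlgCl ℓ) :=
  IntermediateField.adjoin ℚ_[ℓ] ((fun x => ι (g x)) '' (K : Set Qbar))

lemma mem_fixing_locField (ι : Qbar →ₐ[ℚ] PadicAlgCl ℓ) (K : IntermediateField ℚ Qbar) (g : GQ)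
    (s : GLoc ℓ) :
    s ∈ (locField ι K g).fixingSubgroup ↔ ∀ x ∈ K, s (ι (g x)) = ι (g x) := by
  constructor
  · intro h x hx
    exact (IntermediateField.mem_fixingSubgroup_iff _ _).1 h _
      (IntermediateField.subset_adjoin _ _ ⟨x, hx, rfl⟩)
  · intro h
    have h1 : locField ι K g ≤ IntermediateField.fixedField (Subgroup.zpowers s) := by
      refine IntermediateField.adjoin_le_iff.2 ?_
      rintro _ ⟨x, hx, rfl⟩
      refine (IntermediateField.mem_fixedField_iff _ _).2 ?_
      intro f hf
      have h2 : Subgroup.zpowers s ≤ MulAction.stabilizer (GLoc ℓ) (ι (g x)) := by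
        rw [Subgroup.zpowers_le]
        exact h x hx
      exact h2 hf
    refine (IntermediateField.mem_fixingSubgroup_iff _ _).2 fun y hy => ?_
    exact (IntermediateField.mem_fixedField_iff _ _).1 (h1 hy) s (Subgroup.mem_zpowers s)

lemma fixing_locField_anti (ι : Qbar →ₐ[ℚ] PadicAlgCl ℓ) {K K' : IntermediateField ℚ Qbar}
    (h : K ≤ K') (g : GQ) :
    (locField ι K' g).fixingSubgroup ≤ (locField ι K g).fixingSubgroup := by
  intro s hs
  rw [mem_fixing_locField] at hs ⊢
  exact fun x hx => hs x (h hx)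

/-- `H¹(K_v, M) / H¹_nr(K_v, M)` for the prime `v ∣ ℓ` of `K` induced by `ι ∘ g`. -/
abbrev SingQuot (ι : Qbar →ₐ[ℚ] PadicAlgCl ℓ) (φ : Representation ℤ_[p] GQ M)
    (K : IntermediateField ℚ Qbar) (g : GQ) : Type :=
  H1Field (localRep ι g φ) (locField ι K g) ⧸ H1nr (localRep ι g φ) (locField ι K g)

/-- Conjugation `U_{g'} → U_g`, `s ↦ t⁻¹ s t`, for `g' = (res ι t) g u` with `u` fixing `K`. -/
def conjHom (ι : Qbar →ₐ[ℚ] PadicAlgCl ℓ) {K : IntermediateField ℚ Qbar} {g g' : GQ}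
    {t : GLoc ℓ} {u : GQ} (hu : u ∈ K.fixingSubgroup) (h : g' = res ι t * g * u) :
    (locField ι K g').fixingSubgroup →* (locField ι K g).fixingSubgroup where
  toFun s := ⟨t⁻¹ * s * t, by
    have hs := (mem_fixing_locField ι K g' s).1 s.2
    rw [mem_fixing_locField]
    intro x hx
    have h1 := hs x hx
    have h2 : ι (g' x) = t (ι (g x)) := by
      rw [h, AlgEquiv.mul_apply, AlgEquiv.mul_apply,
        (IntermediateField.mem_fixingSubgroup_iff _ _).1 hu x hx, res_spec]
    rw [h2] at h1
    rw [AlgEquiv.mul_apply, AlgEquiv.mul_apply, h1, ← AlgEquiv.mul_apply, inv_mul_cancel,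
      AlgEquiv.one_apply]⟩
  map_one' := by ext1; simp
  map_mul' a b := by ext1; simp [mul_assoc]

lemma conjHom_coe (ι : Qbar →ₐ[ℚ] PadicAlgCl ℓ) {K : IntermediateField ℚ Qbar} {g g' : GQ}
    {t : GLoc ℓ} {u : GQ} (hu : u ∈ K.fixingSubgroup) (h : g' = res ι t * g * u)
    (s : (locField ι K g').fixingSubgroup) : (conjHom ι hu h s : GLoc ℓ) = t⁻¹ * s * t := rfl

lemma continuous_conjHom (ι : Qbar →ₐ[ℚ] PadicAlgCl ℓ) {K : IntermediateField ℚ Qbar} {g g' : GQ}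
    {t : GLoc ℓ} {u : GQ} (hu : u ∈ K.fixingSubgroup) (h : g' = res ι t * g * u) :
    Continuous (conjHom ι hu h) :=
  ((continuous_const.mul continuous_subtype_val).mul continuous_const).subtype_mk _

lemma transport_aux (ι : Qbar →ₐ[ℚ] PadicAlgCl ℓ) (φ : Representation ℤ_[p] GQ M) {g g' : GQ}
    {t : GLoc ℓ} {u : GQ} (h : g' = res ι t * g * u) (s : GLoc ℓ) (x : M) :
    φ u⁻¹ (localRep ι g φ (t⁻¹ * s * t) x) = localRep ι g' φ s (φ u⁻¹ x) := by
  rw [localRep_apply, localRep_apply, ← Module.End.mul_apply, ← map_mul,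
    ← Module.End.mul_apply, ← map_mul]
  congr 2
  subst h
  simp only [map_mul, map_inv]
  group

lemma transport_compat (ι : Qbar →ₐ[ℚ] PadicAlgCl ℓ) (φ : Representation ℤ_[p] GQ M)
    {K : IntermediateField ℚ Qbar} {g g' : GQ} {t : GLoc ℓ} {u : GQ} (hu : u ∈ K.fixingSubgroup)
    (h : g' = res ι t * g * u) (s : (locField ι K g').fixingSubgroup) (x : M) :
    φ u⁻¹ (((localRep ι g φ).comp (locField ι K g).fixingSubgroup.subtype) (conjHom ι hu h s) x) =
      ((localRep ι g' φ).comp (locField ι K g').fixingSubgroup.subtype) s (φ u⁻¹ x) :=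
  transport_aux ι φ h s.1 x

/-- Two embeddings `ι ∘ g` and `ι ∘ g'` of `ℚ̄` induce the same prime `v` of `K` if and only if
`g' = (res ι t) g u` with `t ∈ Gal(ℚ̄_ℓ/ℚ_ℓ)` and `u ∈ Gal(ℚ̄/K)`. This is the resulting canonical
identification between the two models of `H¹(K_v, M)`: a cocycle `z` goes to
`s ↦ u⁻¹ z(t⁻¹ s t)`. -/
def transport (ι : Qbar →ₐ[ℚ] PadicAlgCl ℓ) (φ : Representation ℤ_[p] GQ M)
    (hφ : ∀ g, Continuous (φ g)) {K : IntermediateField ℚ Qbar} {g g' : GQ}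
    {t : GLoc ℓ} {u : GQ} (hu : u ∈ K.fixingSubgroup) (h : g' = res ι t * g * u) :
    H1Field (localRep ι g φ) (locField ι K g) →+ H1Field (localRep ι g' φ) (locField ι K g') :=
  H1.map (conjHom ι hu h) (continuous_conjHom ι hu h) (φ u⁻¹) (hφ u⁻¹)
    (transport_compat ι φ hu h)

lemma transport_nr (ι : Qbar →ₐ[ℚ] PadicAlgCl ℓ) (φ : Representation ℤ_[p] GQ M)
    (hφ : ∀ g, Continuous (φ g)) {K : IntermediateField ℚ Qbar} {g g' : GQ}
    {t : GLoc ℓ} {u : GQ} (hu : u ∈ K.fixingSubgroup) (h : g' = res ι t * g * u) :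
    H1nr (localRep ι g φ) (locField ι K g) ≤
      (H1nr (localRep ι g' φ) (locField ι K g')).comap (transport ι φ hφ hu h) := by
  intro c hc
  obtain ⟨z, rfl⟩ := H1.mk_surjective _ c
  obtain ⟨x, hx⟩ := mem_H1nr_mk.1 hc
  rw [AddSubgroup.mem_comap, transport, H1.map_mk, mem_H1nr_mk]
  refine ⟨φ u⁻¹ x, fun s hs hi => ?_⟩
  rw [Z1.map_apply, ← transport_aux ι φ h, ← map_sub]
  exact congrArg _ (hx _ (conjHom ι hu h ⟨s, hs⟩).2 (conj_mem_inertia t hi))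

/-- The identification `transport` modulo unramified classes. -/
def transportQuot (ι : Qbar →ₐ[ℚ] PadicAlgCl ℓ) (φ : Representation ℤ_[p] GQ M)
    (hφ : ∀ g, Continuous (φ g)) {K : IntermediateField ℚ Qbar} {g g' : GQ}
    {t : GLoc ℓ} {u : GQ} (hu : u ∈ K.fixingSubgroup) (h : g' = res ι t * g * u) :
    SingQuot ι φ K g →+ SingQuot ι φ K g' :=
  QuotientAddGroup.map _ _ (transport ι φ hφ hu h) (transport_nr ι φ hφ hu h)

lemma transportQuot_mk (ι : Qbar →ₐ[ℚ] PadicAlgCl ℓ) (φ : Representation ℤ_[p] GQ M)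
    (hφ : ∀ g, Continuous (φ g)) {K : IntermediateField ℚ Qbar} {g g' : GQ}
    {t : GLoc ℓ} {u : GQ} (hu : u ∈ K.fixingSubgroup) (h : g' = res ι t * g * u)
    (c : H1Field (localRep ι g φ) (locField ι K g)) :
    transportQuot ι φ hφ hu h (QuotientAddGroup.mk' _ c) =
      QuotientAddGroup.mk' _ (transport ι φ hφ hu h c) := rfl

lemma resOn_nr (ι : Qbar →ₐ[ℚ] PadicAlgCl ℓ) (φ : Representation ℤ_[p] GQ M)
    {K K' : IntermediateField ℚ Qbar} (h : K ≤ K') (g : GQ) :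
    H1nr (localRep ι g φ) (locField ι K g) ≤
      (H1nr (localRep ι g φ) (locField ι K' g)).comap
        (resOn (localRep ι g φ) (fixing_locField_anti ι h g)) := by
  intro c hc
  obtain ⟨z, rfl⟩ := H1.mk_surjective _ c
  obtain ⟨x, hx⟩ := mem_H1nr_mk.1 hc
  rw [AddSubgroup.mem_comap, resOn, H1.map_mk, mem_H1nr_mk]
  refine ⟨x, fun s hs hi => ?_⟩
  rw [Z1.map_apply]
  exact hx s (fixing_locField_anti ι h g hs) hi

/-- Restriction `H¹(K_v, M) / H¹_nr → H¹(K'_w, M) / H¹_nr` for `K ⊆ K'` and the primes `w ∣ v`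
induced by the embedding `ι ∘ g`. -/
def resQuot (ι : Qbar →ₐ[ℚ] PadicAlgCl ℓ) (φ : Representation ℤ_[p] GQ M)
    {K K' : IntermediateField ℚ Qbar} (h : K ≤ K') (g : GQ) :
    SingQuot ι φ K g →+ SingQuot ι φ K' g :=
  QuotientAddGroup.map _ _ (resOn _ (fixing_locField_anti ι h g)) (resOn_nr ι φ h g)

lemma resQuot_mk (ι : Qbar →ₐ[ℚ] PadicAlgCl ℓ) (φ : Representation ℤ_[p] GQ M)
    {K K' : IntermediateField ℚ Qbar} (h : K ≤ K') (g : GQ)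
    (c : H1Field (localRep ι g φ) (locField ι K g)) :
    resQuot ι φ h g (QuotientAddGroup.mk' _ c) =
      QuotientAddGroup.mk' _ (resOn _ (fixing_locField_anti ι h g) c) := rfl

lemma conjHom_inclusion (ι : Qbar →ₐ[ℚ] PadicAlgCl ℓ) {K K' : IntermediateField ℚ Qbar}
    (hK : K ≤ K') {g g' : GQ} {t : GLoc ℓ} {u : GQ} (hu : u ∈ K'.fixingSubgroup)
    (hu' : u ∈ K.fixingSubgroup) (h : g' = res ι t * g * u)
    (s : (locField ι K' g').fixingSubgroup) :
    Subgroup.inclusion (fixing_locField_anti ι hK g) (conjHom ι hu h s) =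
      conjHom ι hu' h (Subgroup.inclusion (fixing_locField_anti ι hK g') s) := by
  apply Subtype.ext
  rw [Subgroup.coe_inclusion, conjHom_coe, conjHom_coe, Subgroup.coe_inclusion]

lemma transport_resOn (ι : Qbar →ₐ[ℚ] PadicAlgCl ℓ) (φ : Representation ℤ_[p] GQ M)
    (hφ : ∀ g, Continuous (φ g)) {K K' : IntermediateField ℚ Qbar} (hK : K ≤ K') {g g' : GQ}
    {t : GLoc ℓ} {u : GQ} (hu : u ∈ K'.fixingSubgroup) (hu' : u ∈ K.fixingSubgroup)
    (h : g' = res ι t * g * u) (c : H1Field (localRep ι g φ) (locField ι K g)) :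
    transport ι φ hφ hu h (resOn _ (fixing_locField_anti ι hK g) c) =
      resOn _ (fixing_locField_anti ι hK g') (transport ι φ hφ hu' h c) := by
  obtain ⟨z, rfl⟩ := H1.mk_surjective _ c
  rw [resOn, resOn, transport, transport, H1.map_mk, H1.map_mk, H1.map_mk, H1.map_mk]
  refine congrArg _ (Subtype.ext (funext fun s => ?_))
  rw [Z1.map_apply, Z1.map_apply, Z1.map_apply, Z1.map_apply, LinearMap.id_apply,
    LinearMap.id_apply, conjHom_inclusion ι hK hu hu' h]

lemma transportQuot_resQuot (ι : Qbar →ₐ[ℚ] PadicAlgCl ℓ) (φ : Representation ℤ_[p] GQ M)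
    (hφ : ∀ g, Continuous (φ g)) {K K' : IntermediateField ℚ Qbar} (hK : K ≤ K') {g g' : GQ}
    {t : GLoc ℓ} {u : GQ} (hu : u ∈ K'.fixingSubgroup) (hu' : u ∈ K.fixingSubgroup)
    (h : g' = res ι t * g * u) (d : SingQuot ι φ K g) :
    transportQuot ι φ hφ hu h (resQuot ι φ hK g d) =
      resQuot ι φ hK g' (transportQuot ι φ hφ hu' h d) := by
  obtain ⟨c, rfl⟩ := QuotientAddGroup.mk'_surjective _ d
  rw [resQuot_mk, transportQuot_mk, transportQuot_mk, resQuot_mk,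
    transport_resOn ι φ hφ hK hu hu' h]

/-- `J_ℓ^Gr(M/K) = ⨁_{v ∣ ℓ} H¹(K_v, M) / H¹_nr(K_v, M)` for `ℓ ≠ p` and a number field `K ⊆ ℚ̄`,
where `v` runs over the (finitely many) primes of `K` above `ℓ`. The primes `v` are presented
through the embeddings `ℚ̄ → ℚ̄_ℓ`, all of which have the form `ι ∘ g` with a unique `g`: an element
is a family of classes, one for every `g`, that agree under the canonical identifications
whenever two embeddings induce the same `v`. -/
def JGr (ι : Qbar →ₐ[ℚ] PadicAlgCl ℓ) (φ : Representation ℤ_[p] GQ M)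
    (hφ : ∀ g, Continuous (φ g)) (K : IntermediateField ℚ Qbar) :
    AddSubgroup (∀ g : GQ, SingQuot ι φ K g) where
  carrier := {c | ∀ (g g' : GQ) (t : GLoc ℓ) (u : GQ) (hu : u ∈ K.fixingSubgroup)
    (h : g' = res ι t * g * u), transportQuot ι φ hφ hu h (c g) = c g'}
  zero_mem' := fun g g' t u hu h => by simp
  add_mem' := fun {a b} ha hb g g' t u hu h => by
    simp only [Pi.add_apply, map_add, ha g g' t u hu h, hb g g' t u hu h]
  neg_mem' := fun {a} ha g g' t u hu h => by
    simp only [Pi.neg_apply, map_neg, ha g g' t u hu h]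

/-- The restriction map `J_ℓ^Gr(M/K) → J_ℓ^Gr(M/K')` for `K ⊆ K'`. -/
def JGrRes (ι : Qbar →ₐ[ℚ] PadicAlgCl ℓ) (φ : Representation ℤ_[p] GQ M)
    (hφ : ∀ g, Continuous (φ g)) {K K' : IntermediateField ℚ Qbar} (h : K ≤ K') :
    JGr ι φ hφ K →+ JGr ι φ hφ K' where
  toFun c := ⟨fun g => resQuot ι φ h g (c.1 g), fun g g' t u hu hg => by
    have hu' : u ∈ K.fixingSubgroup := IntermediateField.fixingSubgroup_antitone h hu
    rw [transportQuot_resQuot ι φ hφ h hu hu' hg, c.2 g g' t u hu' hg]⟩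
  map_zero' := by
    ext g
    exact map_zero (resQuot ι φ h g)
  map_add' a b := by
    ext g
    exact map_add (resQuot ι φ h g) (a.1 g) (b.1 g)

lemma mem_fixing_bot (s : GLoc ℓ) :
    s ∈ (⊥ : IntermediateField ℚ_[ℓ] (PadicAlgCl ℓ)).fixingSubgroup := by
  rw [IntermediateField.fixingSubgroup_bot]
  trivial

lemma toLoc_compat (ι : Qbar →ₐ[ℚ] PadicAlgCl ℓ) (φ : Representation ℤ_[p] GQ M)
    {U U' : Subgroup (GLoc ℓ)} (hU : U' ≤ U) (g : GQ) (s : U') (x : M) :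
    φ g⁻¹ (((φ.comp (res ι)).comp U.subtype) (Subgroup.inclusion hU s) x) =
      ((localRep ι g φ).comp U'.subtype) s (φ g⁻¹ x) := by
  change φ g⁻¹ (φ (res ι s) x) = localRep ι g φ s (φ g⁻¹ x)
  rw [localRep_apply, ← Module.End.mul_apply, ← map_mul, ← Module.End.mul_apply, ← map_mul]
  congr 2
  group

/-- The restriction map `H¹(ℚ_ℓ, M) → H¹(K_v, M)` for the prime `v` of `K` induced by `ι ∘ g`. It
sends a cocycle `z` to `s ↦ g⁻¹ z(s)`: multiplication by `g⁻¹` identifies the local Galois module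
attached to `ι` with the one attached to `ι ∘ g`. -/
def toLoc (ι : Qbar →ₐ[ℚ] PadicAlgCl ℓ) (φ : Representation ℤ_[p] GQ M)
    (hφ : ∀ g, Continuous (φ g)) (K : IntermediateField ℚ Qbar) (g : GQ) :
    H1Field (φ.comp (res ι)) ⊥ →+ H1Field (localRep ι g φ) (locField ι K g) :=
  H1.map (Subgroup.inclusion (IntermediateField.fixingSubgroup_antitone bot_le))
    (continuous_inclusion _) (φ g⁻¹) (hφ g⁻¹) (toLoc_compat ι φ _ g)

lemma transport_toLoc (ι : Qbar →ₐ[ℚ] PadicAlgCl ℓ) (φ : Representation ℤ_[p] GQ M)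
    (hφ : ∀ g, Continuous (φ g)) {K : IntermediateField ℚ Qbar} {g g' : GQ}
    {t : GLoc ℓ} {u : GQ} (hu : u ∈ K.fixingSubgroup) (h : g' = res ι t * g * u)
    (c : H1Field (φ.comp (res ι)) ⊥) :
    transport ι φ hφ hu h (toLoc ι φ hφ K g c) = toLoc ι φ hφ K g' c := by
  obtain ⟨z, rfl⟩ := H1.mk_surjective _ c
  rw [toLoc, toLoc, transport, H1.map_mk, H1.map_mk, H1.map_mk, ← sub_eq_zero, ← map_sub,
    H1.mk_eq_zero]
  have hz : ∀ a b : GLoc ℓ, z.1 ⟨a * b, mem_fixing_bot _⟩ =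
      z.1 ⟨a, mem_fixing_bot a⟩ + φ (res ι a) (z.1 ⟨b, mem_fixing_bot b⟩) :=
    fun a b => z.2.2 ⟨a, mem_fixing_bot a⟩ ⟨b, mem_fixing_bot b⟩
  refine ⟨φ g'⁻¹ (z.1 ⟨t, mem_fixing_bot t⟩), fun s => ?_⟩
  obtain ⟨s, hs⟩ := s
  change φ u⁻¹ (φ g⁻¹ (z.1 ⟨t⁻¹ * s * t, mem_fixing_bot _⟩)) - φ g'⁻¹ (z.1 ⟨s, mem_fixing_bot s⟩) =
    localRep ι g' φ s (φ g'⁻¹ (z.1 ⟨t, mem_fixing_bot t⟩)) - φ g'⁻¹ (z.1 ⟨t, mem_fixing_bot t⟩)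
  have h1 : z.1 ⟨1, mem_fixing_bot 1⟩ = 0 := by
    have := hz 1 1
    simpa using this
  have h2 : z.1 ⟨t⁻¹, mem_fixing_bot _⟩ = - φ (res ι t⁻¹) (z.1 ⟨t, mem_fixing_bot t⟩) := by
    have := hz t⁻¹ t
    simp only [inv_mul_cancel, h1] at this
    exact eq_neg_of_add_eq_zero_left this.symm
  rw [hz, hz, h2, localRep_apply]
  simp only [map_add, map_neg, ← Module.End.mul_apply, ← map_mul]
  have e1 : u⁻¹ * (g⁻¹ * res ι t⁻¹) = g'⁻¹ := by
    rw [h, map_inv]; group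
  have e2 : u⁻¹ * (g⁻¹ * res ι (t⁻¹ * s)) = g'⁻¹ * res ι s * g' * g'⁻¹ := by
    rw [h]; simp only [map_mul, map_inv]; group
  rw [e1, e2]
  abel

/-- The map `H¹(ℚ_ℓ, M) → J_ℓ^Gr(M/K)` given by restriction to all primes `v ∣ ℓ` of `K`. -/
def toJGr (ι : Qbar →ₐ[ℚ] PadicAlgCl ℓ) (φ : Representation ℤ_[p] GQ M)
    (hφ : ∀ g, Continuous (φ g)) (K : IntermediateField ℚ Qbar) :
    H1Field (φ.comp (res ι)) ⊥ →+ JGr ι φ hφ K where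
  toFun c := ⟨fun g => QuotientAddGroup.mk' _ (toLoc ι φ hφ K g c), fun g g' t u hu h => by
    rw [transportQuot_mk, transport_toLoc]⟩
  map_zero' := by
    ext g
    exact map_zero ((QuotientAddGroup.mk' _).comp (toLoc ι φ hφ K g))
  map_add' a b := by
    ext g
    exact map_add ((QuotientAddGroup.mk' _).comp (toLoc ι φ hφ K g)) a b

/-- `J_ℓ^Gr(M/ℚ_∞) = lim_n J_ℓ^Gr(M/ℚ_n)`, the direct limit along the restriction maps over the
layers `ℚ_n` of the cyclotomic `ℤ_p`-extension. -/
abbrev JGrInf (ι : Qbar →ₐ[ℚ] PadicAlgCl ℓ) (φ : Representation ℤ_[p] GQ M)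
    (hφ : ∀ g, Continuous (φ g)) : Type :=
  AddCommGroup.DirectLimit (fun n : ℕ => JGr ι φ hφ (layer p n))
    (fun _ _ h => JGrRes ι φ hφ (layer_mono p h))

/-- The restriction map `H¹(ℚ_ℓ, M) → J_ℓ^Gr(M/ℚ_∞)` (note that `ℚ_0 = ℚ`). -/
def toJGrInf (ι : Qbar →ₐ[ℚ] PadicAlgCl ℓ) (φ : Representation ℤ_[p] GQ M)
    (hφ : ∀ g, Continuous (φ g)) : H1Field (φ.comp (res ι)) ⊥ →+ JGrInf ι φ hφ :=
  (AddCommGroup.DirectLimit.of (fun n : ℕ => JGr ι φ hφ (layer p n))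
    (fun _ _ h => JGrRes ι φ hφ (layer_mono p h)) 0).comp (toJGr ι φ hφ (layer p 0))

lemma toJGr_of_nr (ι : Qbar →ₐ[ℚ] PadicAlgCl ℓ) (φ : Representation ℤ_[p] GQ M)
    (hφ : ∀ g, Continuous (φ g)) (K : IntermediateField ℚ Qbar)
    {c : H1Field (φ.comp (res ι)) ⊥} (hc : c ∈ H1nr (φ.comp (res ι)) ⊥) :
    toJGr ι φ hφ K c = 0 := by
  ext g
  refine (QuotientAddGroup.eq_zero_iff _).2 ?_
  obtain ⟨z, rfl⟩ := H1.mk_surjective _ c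
  obtain ⟨x, hx⟩ := mem_H1nr_mk.1 hc
  rw [toLoc, H1.map_mk, mem_H1nr_mk]
  refine ⟨φ g⁻¹ x, fun s hs hi => ?_⟩
  rw [Z1.map_apply]
  refine (congrArg (φ g⁻¹) (hx s (mem_fixing_bot s) hi)).trans ?_
  have e := toLoc_compat ι φ (IntermediateField.fixingSubgroup_antitone bot_le) g ⟨s, hs⟩ x
  exact (map_sub _ _ _).trans (congrArg (· - φ g⁻¹ x) e)

end LocalCohomology

namespace GaloisLattice

variable (Λ : GaloisLattice p) (ι : Qbar →ₐ[ℚ] PadicAlgCl ℓ)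

lemma mapVA_compat (U : Subgroup (GLoc ℓ)) (s : U) (x : Vsp p) :
    Λ.lattice.mkQ (((Λ.repV.comp (res ι)).comp U.subtype) (MonoidHom.id _ s) x) =
      ((Λ.repA.comp (res ι)).comp U.subtype) s (Λ.lattice.mkQ x) :=
  rfl

/-- The map `H¹(ℚ_ℓ, V) → H¹(ℚ_ℓ, A)` induced by `V → A = V / T`. -/
def mapVA : H1Field (Λ.repV.comp (res ι)) ⊥ →+ H1Field (Λ.repA.comp (res ι)) ⊥ :=
  H1.map (MonoidHom.id _) continuous_id Λ.lattice.mkQ Λ.continuous_mkQ (Λ.mapVA_compat ι _)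

/-- The Bloch--Kato condition `H¹_f(ℚ_ℓ, A)` for `ℓ ≠ p`: the image of
`H¹_f(ℚ_ℓ, V) = H¹_nr(ℚ_ℓ, V)`. -/
def H1f : AddSubgroup (H1Field (Λ.repA.comp (res ι)) ⊥) :=
  (H1nr (Λ.repV.comp (res ι)) ⊥).map (Λ.mapVA ι)

lemma H1f_le_nr : Λ.H1f ι ≤ H1nr (Λ.repA.comp (res ι)) ⊥ := by
  rintro _ ⟨c, hc, rfl⟩
  obtain ⟨z, rfl⟩ := H1.mk_surjective _ c
  obtain ⟨x, hx⟩ := mem_H1nr_mk.1 hc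
  rw [mapVA, H1.map_mk, mem_H1nr_mk]
  refine ⟨Λ.lattice.mkQ x, fun s hs hi => ?_⟩
  rw [Z1.map_apply]
  refine (congrArg Λ.lattice.mkQ (hx s hs hi)).trans ?_
  rw [map_sub]
  rfl

/-- `J_ℓ^BK(A/ℚ) = H¹(ℚ_ℓ, A) / H¹_f(ℚ_ℓ, A)`. -/
abbrev JBK : Type := H1Field (Λ.repA.comp (res ι)) ⊥ ⧸ Λ.H1f ι

/-- The restriction map `h_{ℓ,A} : J_ℓ^BK(A/ℚ) → J_ℓ^Gr(A/ℚ_∞)`. Its image consists of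
`Gal(ℚ_∞/ℚ)`-invariants, and its kernel does not depend on whether the target is
`J_ℓ^Gr(A/ℚ_∞)` or the subgroup of these invariants. -/
def h : Λ.JBK ι →+ JGrInf ι Λ.repA Λ.continuous_repA :=
  QuotientAddGroup.lift (Λ.H1f ι) (toJGrInf ι Λ.repA Λ.continuous_repA) (fun c hc => by
    rw [AddMonoidHom.mem_ker, toJGrInf, AddMonoidHom.comp_apply,
      toJGr_of_nr ι Λ.repA Λ.continuous_repA _ (Λ.H1f_le_nr ι hc), map_zero])

/-- `δ_ℓ(A) = dim_{𝔽_p} (ker h_{ℓ,A})[p]`, as a cardinal number. -/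
def delta : Cardinal :=
  letI : Module (ZMod p) (AddSubgroup.torsionBy (Λ.h ι).ker (p : ℤ)) :=
    AddSubgroup.torsionBy.zmodModule
  Module.rank (ZMod p) (AddSubgroup.torsionBy (Λ.h ι).ker (p : ℤ))

end GaloisLattice

end Delta

/-! ### The representations and the two lattices -/

section Lattices

variable {p : ℕ} [Fact p.Prime]

/-- The Teichmüller lift `β̃ : G_ℚ → ℤ_pˣ` of a character `β : G_ℚ → 𝔽_pˣ`. -/
def teichLift (β : GQ →* (ZMod p)ˣ) : GQ →* ℤ_[p]ˣ :=
  (Units.map ((WittVector.equiv p).toMonoidHom.comp (WittVector.teichmuller p))).comp β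

/-- The representation `ρ ⊗ ψ`, `g ↦ ψ(g) ρ(g)`, with values in `2 × 2` matrices over `ℤ_p`. -/
def twist (ρ : GQ →* GL (Fin 2) ℤ_[p]) (ψ : GQ →* ℤ_[p]ˣ) :
    GQ →* Matrix (Fin 2) (Fin 2) ℤ_[p] where
  toFun g := (ψ g : ℤ_[p]) • (ρ g : Matrix (Fin 2) (Fin 2) ℤ_[p])
  map_one' := by simp
  map_mul' a b := by
    simp only [map_mul, Units.val_mul, Matrix.smul_mul, Matrix.mul_smul, smul_smul]
    rw [mul_comm]

/-- The action of a matrix representation over `ℤ_p` on the column space `V = ℚ_p²`. -/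
def ratRep (R : GQ →* Matrix (Fin 2) (Fin 2) ℤ_[p]) : Representation ℚ_[p] GQ (Vsp p) where
  toFun g := Matrix.toLin' ((R g).map (algebraMap ℤ_[p] ℚ_[p]))
  map_one' := by
    rw [map_one, Matrix.map_one _ (map_zero _) (map_one _), Matrix.toLin'_one]
    rfl
  map_mul' a b := by
    simp [Matrix.map_mul, Matrix.toLin'_mul, Module.End.mul_eq_comp]

lemma ratRep_apply (R : GQ →* Matrix (Fin 2) (Fin 2) ℤ_[p]) (g : GQ) (v : Vsp p) :
    ratRep R g v = ((R g).map (algebraMap ℤ_[p] ℚ_[p])) *ᵥ v := by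
  simp [ratRep, Matrix.toLin'_apply]

/-- The reduction `GL₂(ℤ_p) → GL₂(𝔽_p)`. -/
abbrev redGL (p : ℕ) [Fact p.Prime] : GL (Fin 2) ℤ_[p] →* GL (Fin 2) (ZMod p) :=
  Matrix.GeneralLinearGroup.map PadicInt.toZMod

/-- The residual representation has the form `ρ̄ = (χ̄ β² *; 0 1)`, with `χ̄` the mod `p` cyclotomic
character. -/
structure IsResidual (rbar : GQ →* GL (Fin 2) (ZMod p)) (β : GQ →* (ZMod p)ˣ) : Prop where
  continuous_rbar : Continuous rbar
  continuous_beta : Continuous β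
  apply_zero_zero : ∀ g, rbar g 0 0 = PadicInt.toZMod (chi p g : ℤ_[p]) * (β g : ZMod p) ^ 2
  apply_one_zero : ∀ g, rbar g 1 0 = 0
  apply_one_one : ∀ g, rbar g 1 1 = 1

/-- `ρ : G_ℚ → GL₂(ℤ_p)` is a continuous lift of `ρ̄`. -/
structure IsLift (ρ : GQ →* GL (Fin 2) ℤ_[p]) (rbar : GQ →* GL (Fin 2) (ZMod p)) : Prop where
  continuous_rho : Continuous ρ
  red : ∀ g, redGL p (ρ g) = rbar g

lemma IsLift.dvd {ρ : GQ →* GL (Fin 2) ℤ_[p]} {rbar : GQ →* GL (Fin 2) (ZMod p)}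
    (hl : IsLift ρ rbar) (h : ∀ g, rbar g 1 0 = 0) (g : GQ) : (p : ℤ_[p]) ∣ ρ g 1 0 := by
  have h1 : PadicInt.toZMod (ρ g 1 0) = 0 := by
    rw [← h g, ← hl.red g]
    rfl
  rw [← RingHom.mem_ker, PadicInt.ker_toZMod, PadicInt.maximalIdeal_eq_span_p,
    Ideal.mem_span_singleton] at h1
  exact h1

/-- The lattice `T = ℤ_p e₁ ⊕ ℤ_p e₂` in the representation `V` of `ρ ⊗ ψ`. -/
def latticeT (ρ : GQ →* GL (Fin 2) ℤ_[p]) (ψ : GQ →* ℤ_[p]ˣ) : GaloisLattice p where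
  rep := ratRep (twist ρ ψ)
  lattice := Submodule.span ℤ_[p] {![1, 0], ![0, 1]}
  stable := by
    intro g v hv
    rw [Submodule.mem_span_pair] at hv ⊢
    obtain ⟨a, b, rfl⟩ := hv
    refine ⟨twist ρ ψ g 0 0 * a + twist ρ ψ g 0 1 * b,
      twist ρ ψ g 1 0 * a + twist ρ ψ g 1 1 * b, ?_⟩
    rw [ratRep_apply]
    ext i
    fin_cases i <;> simp [Matrix.mulVec, dotProduct, Fin.sum_univ_two, Algebra.smul_def]

/-- The lattice `T' = ℤ_p p⁻¹e₁ ⊕ ℤ_p e₂` in the representation `V` of `ρ ⊗ ψ`. It is Galois stable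
because the lower left entries of `ρ` are divisible by `p`. -/
def latticeT' (ρ : GQ →* GL (Fin 2) ℤ_[p]) (ψ : GQ →* ℤ_[p]ˣ)
    (hρ : ∀ g, (p : ℤ_[p]) ∣ ρ g 1 0) : GaloisLattice p where
  rep := ratRep (twist ρ ψ)
  lattice := Submodule.span ℤ_[p] {![(p : ℚ_[p])⁻¹, 0], ![0, 1]}
  stable := by
    intro g v hv
    rw [Submodule.mem_span_pair] at hv ⊢
    obtain ⟨a, b, rfl⟩ := hv
    obtain ⟨c, hc⟩ := hρ g
    have hp : (p : ℚ_[p]) ≠ 0 := Nat.cast_ne_zero.2 (Fact.out : p.Prime).ne_zero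
    have hc' : twist ρ ψ g 1 0 = p * (ψ g * c) := by
      change (ψ g : ℤ_[p]) * ρ g 1 0 = _
      rw [hc]
      ring
    refine ⟨twist ρ ψ g 0 0 * a + p * twist ρ ψ g 0 1 * b,
      ψ g * c * a + twist ρ ψ g 1 1 * b, ?_⟩
    rw [ratRep_apply]
    ext i
    fin_cases i
    · simp [Matrix.mulVec, dotProduct, Fin.sum_univ_two, Algebra.smul_def]
      field_simp
    · simp [Matrix.mulVec, dotProduct, Fin.sum_univ_two, Algebra.smul_def, hc']
      field_simp

variable {ℓ : ℕ} [Fact ℓ.Prime]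

/-- `ℓ` is a trivial prime: `ℓ ≡ 1 mod p`, `ℓ ≢ 1 mod p²`, and `ρ̄` is trivial on the decomposition
group at `ℓ`. -/
structure IsTrivialPrime (rbar : GQ →* GL (Fin 2) (ZMod p)) (ι : Qbar →ₐ[ℚ] PadicAlgCl ℓ) :
    Prop where
  modEq : ℓ ≡ 1 [MOD p]
  not_modEq : ¬ ℓ ≡ 1 [MOD p ^ 2]
  trivial : ∀ s : GLoc ℓ, rbar (res ι s) = 1

/-- The local condition of Type II at `ℓ`: up to strict equivalence (conjugation by a matrix
`C ≡ 1 mod p`) `ϱ` takes the values `(1 0; x ℓ)` at `σ` and `(1 0; y 1)` at `τ`, with `p² ∣ x` and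
`p ∥ y`. -/
def IsTypeII (σ : GLoc ℓ) (τ : inertia ℓ) (ϱ : GLoc ℓ →* GL (Fin 2) ℤ_[p]) : Prop :=
  ∃ C : GL (Fin 2) ℤ_[p], redGL p C = 1 ∧ ∃ x y : ℤ_[p],
    (p : ℤ_[p]) ^ 2 ∣ x ∧ (p : ℤ_[p]) ∣ y ∧ ¬ (p : ℤ_[p]) ^ 2 ∣ y ∧
    ((C * ϱ σ * C⁻¹ : GL (Fin 2) ℤ_[p]) : Matrix (Fin 2) (Fin 2) ℤ_[p]) = !![1, 0; x, (ℓ : ℤ_[p])] ∧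
    ((C * ϱ (τ : GLoc ℓ) * C⁻¹ : GL (Fin 2) ℤ_[p]) : Matrix (Fin 2) (Fin 2) ℤ_[p]) =
      !![1, 0; y, 1]

end Lattices

end TypeTwo

end

open scoped Matrix

noncomputable section

namespace TypeTwo

/-! ### The decomposition group is topologically generated by inertia and a Frobenius element -/

/-! The kernel of `h` is a quotient of unramified classes. Since `ℓ ≠ p`, the cyclotomic character
is trivial on inertia, so inertia at `ℓ` fixes every layer `ℚ_n`. Hence restriction to `ℚ_∞` loses
nothing on inertia, and a class over `ℚ_ℓ` dies in `J^Gr` exactly when it is already unramified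
(`toJGrInf_eq_zero_iff`). So `ker h = H¹_nr(ℚ_ℓ, B) / H¹_f(ℚ_ℓ, B)`.

Inertia and a Frobenius `σ` topologically generate the decomposition group
(`IsFrobenius.eq_top_of_isClosed`). An unramified class is therefore controlled by its value at `σ`,
an element of `B^I` taken modulo `(σ - 1) B^I` (`H1nr_eq_bot`, `H1.mk_eq_zero_of_frobenius`).
Because `ρ` is residually trivial at `ℓ`, inertia acts through pro-`p` quotients, and invariance
modulo a lattice can be tested on `τ` alone when the twist is trivial on inertia
(`inLat_act_sub_of_tame`).

The Type II shape then leaves linear algebra. In the coordinates `(v₀, v₁)` given by `C`, `τ - 1`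
sends `v` to `(0, y v₀)`. As `p` exactly divides `y`, an invariant class has `v₀ ∈ p⁻¹ℤ_p`, while
`v₁` is free (`norm_le_of_tame_fixed`). On the line `v₀ = 0`, Frobenius acts by `±ℓ ≠ 1`, so `σ - 1`
maps that divisible line onto itself and removes `v₁`. What remains is `v₀` in `p⁻¹ℤ_p` modulo the
first coordinates of the lattice: nothing for `T'`, a group of order `p` for `T`.

For `A'` the twist `ψ` may be nontrivial at `ℓ`, but it takes only the values `±1` on inertia and at
`σ`. If it is `-1` somewhere on inertia, then `A'^I = 0` (`inLat_of_act_eq_neg`).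

For `A`, the invariants `V^I` form a line on which `σ - 1` is invertible, so `H¹_f = 0`
(`H1f_latticeT_eq_bot`). The group of order `p` is generated by the explicit cocycle `s ↦ (χ(s) - 1)
p⁻² f`, with `f` the first `C`-coordinate vector (`exists_chiCocycle`). Its value at `σ` is `(u/p)
f`, where `ℓ = 1 + p u`, and `u` is prime to `p` because `ℓ ≢ 1 mod p²`. -/

lemma pow_pow_mul_eq_self {k : Type*} [Monoid k] {x : k} {q N : ℕ} (h : x ^ q ^ N = x) (d : ℕ) :
    x ^ q ^ (N * d) = x := by
  induction d with
  | zero => simp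
  | succ d ih => rw [Nat.mul_succ, pow_add, pow_mul, ih, h]

/-- A ring endomorphism of a field of characteristic `q` is a power of Frobenius on the elements
fixed by the `N`-th power of Frobenius. -/
lemma exists_eq_pow_of_pow_eq {k : Type*} [Field k] {q : ℕ} [Fact q.Prime] [CharP k q]
    (f : k →+* k) {N : ℕ} (hN : N ≠ 0) : ∃ m : ℕ, ∀ x : k, x ^ q ^ N = x → f x = x ^ q ^ m := by
  let E : Subfield k := RingHom.eqLocusField (iterateFrobenius k q N) (RingHom.id k)
  have hE : ∀ x : k, x ∈ E ↔ x ^ q ^ N = x := fun x => by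
    change iterateFrobenius k q N x = x ↔ _
    rw [iterateFrobenius_def]
  have hq : 1 < q ^ N := Nat.one_lt_pow hN (Fact.out : q.Prime).one_lt
  have hfin : Finite E := by
    have h0 : (Polynomial.X ^ q ^ N - Polynomial.X : Polynomial k) ≠ 0 :=
      FiniteField.X_pow_card_sub_X_ne_zero k hq
    refine Set.Finite.subset ((Polynomial.X ^ q ^ N - Polynomial.X : Polynomial k).rootSet_finite k)
      fun x hx => ?_
    rw [Polynomial.mem_rootSet]
    refine ⟨h0, ?_⟩
    simp [(hE x).1 hx]
  let _ : Algebra (ZMod q) E := ZMod.algebra E q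
  let fE : E →+* E := (f.comp E.subtype).codRestrict E fun x => by
    rw [hE, RingHom.comp_apply, ← map_pow]
    exact congrArg f ((hE x).1 x.2)
  let fA : E →ₐ[ZMod q] E :=
    { fE with
      commutes' := fun r => RingHom.congr_fun
        (Subsingleton.elim (fE.comp (algebraMap (ZMod q) E)) (algebraMap (ZMod q) E)) r }
  -- `E` is finite, being a set of roots of `X ^ q ^ N - X`, so its endomorphisms over the prime
  -- field are powers of Frobenius.
  obtain ⟨n, hn⟩ := (FiniteField.bijective_frobeniusAlgHom_pow (ZMod q) E).2 fA
  refine ⟨n, fun x hx => ?_⟩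
  have h1 := DFunLike.congr_fun hn ⟨x, (hE x).2 hx⟩
  simp only [AlgHom.coe_pow, FiniteField.coe_frobeniusAlgHom, pow_iterate, ZMod.card] at h1
  exact (congrArg Subtype.val h1).symm

/-! ### The residue field of `ℚ̄_ℓ` and the Galois action on it -/

section Residue

variable (ℓ : ℕ) [Fact ℓ.Prime]

/-- The valuation ring of `ℚ̄_ℓ`. -/
abbrev IntegerRing : ValuationSubring (PadicAlgCl ℓ) := (PadicAlgCl.valued ℓ).v.valuationSubring

/-- The residue field of `ℚ̄_ℓ`. -/
abbrev ResidueFld : Type := IsLocalRing.ResidueField (IntegerRing ℓ)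

variable {ℓ}

lemma mem_integerRing {x : PadicAlgCl ℓ} : x ∈ IntegerRing ℓ ↔ ‖x‖ ≤ 1 := by
  rw [Valuation.mem_valuationSubring_iff, PadicAlgCl.valuation_def]
  exact Iff.rfl

lemma residue_eq_zero {x : IntegerRing ℓ} :
    IsLocalRing.residue (IntegerRing ℓ) x = 0 ↔ ‖(x : PadicAlgCl ℓ)‖ < 1 := by
  rw [IsLocalRing.residue_eq_zero_iff, IsLocalRing.mem_maximalIdeal, mem_nonunits_iff]
  refine (Valuation.Integer.not_isUnit_iff_valuation_lt_one (v := (PadicAlgCl.valued ℓ).v)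
    (x := x)).trans ?_
  rw [PadicAlgCl.valuation_def]
  exact Iff.rfl

lemma residue_eq_iff {x y : IntegerRing ℓ} :
    IsLocalRing.residue (IntegerRing ℓ) x = IsLocalRing.residue (IntegerRing ℓ) y ↔
      ‖(x - y : PadicAlgCl ℓ)‖ < 1 := by
  rw [← sub_eq_zero, ← map_sub, residue_eq_zero]
  rfl

lemma norm_natCast_prime_lt_one : ‖((ℓ : ℕ) : PadicAlgCl ℓ)‖ < 1 := by
  have := PadicAlgCl.norm_extends ℓ (ℓ : ℚ_[ℓ])
  rw [map_natCast] at this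
  rw [this]
  exact Padic.norm_p_lt_one

instance : CharP (ResidueFld ℓ) ℓ := by
  refine (CharP.charP_iff_prime_eq_zero (Fact.out : ℓ.Prime)).2 ?_
  rw [← map_natCast (IsLocalRing.residue (IntegerRing ℓ)), residue_eq_zero]
  exact norm_natCast_prime_lt_one

/-- The action of the Galois group on the valuation ring. -/
def galInt (s : GLoc ℓ) : IntegerRing ℓ →+* IntegerRing ℓ :=
  ((s : PadicAlgCl ℓ →+* PadicAlgCl ℓ).comp (IntegerRing ℓ).subtype).codRestrict
    (IntegerRing ℓ).toSubring fun x =>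
      mem_integerRing.2 ((norm_gal s x).trans_le (mem_integerRing.1 x.2))

lemma galInt_coe (s : GLoc ℓ) (x : IntegerRing ℓ) : (galInt s x : PadicAlgCl ℓ) = s x := rfl

/-- The action of the Galois group on the residue field. -/
def galRes (s : GLoc ℓ) : ResidueFld ℓ →+* ResidueFld ℓ :=
  Ideal.Quotient.lift _ ((IsLocalRing.residue _).comp (galInt s)) fun x hx => by
    have h : ‖(x : PadicAlgCl ℓ)‖ < 1 :=
      residue_eq_zero.1 ((IsLocalRing.residue_eq_zero_iff x).2 hx)
    rw [RingHom.comp_apply, residue_eq_zero, galInt_coe, norm_gal]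
    exact h

lemma galRes_residue (s : GLoc ℓ) (x : IntegerRing ℓ) :
    galRes s (IsLocalRing.residue _ x) = IsLocalRing.residue _ (galInt s x) := rfl

/-- The residue field is algebraic over `𝔽_ℓ`. The norm is the spectral norm, so an integral element
has minimal polynomial with coefficients in `ℤ_ℓ`. That polynomial is monic, so its reduction is
nonzero and kills the residue, which therefore generates a finite field. -/
lemma exists_pow_eq_self (x : ResidueFld ℓ) : ∃ N : ℕ, N ≠ 0 ∧ x ^ ℓ ^ N = x := by
  obtain ⟨x, rfl⟩ := IsLocalRing.residue_surjective x
  let _ : Algebra (ZMod ℓ) (ResidueFld ℓ) := ZMod.algebra _ ℓ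
  let φ : ℤ_[ℓ] →+* ResidueFld ℓ := (IsLocalRing.residue _).comp
    (((algebraMap ℚ_[ℓ] (PadicAlgCl ℓ)).comp PadicInt.Coe.ringHom).codRestrict
      (IntegerRing ℓ).toSubring fun c => mem_integerRing.2 (by
        change ‖algebraMap ℚ_[ℓ] (PadicAlgCl ℓ) c‖ ≤ 1
        exact (PadicAlgCl.norm_extends ℓ _).trans_le c.2))
  have hφ : ∀ c : ℤ_[ℓ], algebraMap (ZMod ℓ) (ResidueFld ℓ) (PadicInt.toZMod c) = φ c := by
    intro c
    have h := PadicInt.toZMod_spec c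
    rw [PadicInt.maximalIdeal_eq_span_p, Ideal.mem_span_singleton] at h
    obtain ⟨d, hd⟩ := h
    have h1 : c = (ZMod.cast (PadicInt.toZMod c) : ℤ_[ℓ]) + ℓ * d := by rw [← hd]; ring
    have h2 : (ZMod.cast (PadicInt.toZMod c) : ℤ_[ℓ]) = ((PadicInt.toZMod c).val : ℤ_[ℓ]) :=
      ZMod.cast_eq_val _
    conv_rhs => rw [h1, h2]
    rw [map_add, map_mul, map_natCast, map_natCast, CharP.cast_eq_zero (ResidueFld ℓ) ℓ, zero_mul, add_zero]
    rw [← map_natCast (algebraMap (ZMod ℓ) (ResidueFld ℓ)), ZMod.natCast_zmod_val]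
  have hint : IsIntegral ℚ_[ℓ] (x : PadicAlgCl ℓ) := Algebra.IsIntegral.isIntegral _
  have hcoeff := (spectralValue_le_one_iff (minpoly.monic hint)).1 (mem_integerRing.1 x.2)
  set f := minpoly ℚ_[ℓ] (x : PadicAlgCl ℓ) with hf
  choose c hc using fun i => (⟨⟨f.coeff i, hcoeff i⟩, rfl⟩ : ∃ c : ℤ_[ℓ], (c : ℚ_[ℓ]) = f.coeff i)
  let g : Polynomial (ZMod ℓ) := ∑ i ∈ Finset.range (f.natDegree + 1),
    Polynomial.C (PadicInt.toZMod (c i)) * Polynomial.X ^ i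
  have hg : g ≠ 0 := by
    intro h0
    have h1 : g.coeff f.natDegree = 1 := by
      simp only [g, Polynomial.finsetSum_coeff, Polynomial.coeff_C_mul_X_pow]
      rw [Finset.sum_ite_eq, if_pos (Finset.self_mem_range_succ _)]
      have h2 : c f.natDegree = 1 :=
        Subtype.ext ((hc _).trans (minpoly.monic hint).coeff_natDegree)
      rw [h2, map_one]
    rw [h0, Polynomial.coeff_zero] at h1
    exact zero_ne_one h1
  have hroot : Polynomial.aeval (IsLocalRing.residue _ x) g = 0 := by
    simp only [g, map_sum, map_mul, Polynomial.aeval_C, map_pow, Polynomial.aeval_X, hφ]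
    simp only [φ, RingHom.comp_apply, ← map_pow, ← map_mul, ← map_sum]
    rw [residue_eq_zero]
    have h1 : Polynomial.aeval (x : PadicAlgCl ℓ) f = 0 := minpoly.aeval _ _
    rw [Polynomial.aeval_eq_sum_range] at h1
    have h2 : ‖(0 : PadicAlgCl ℓ)‖ < 1 := by simp
    rw [← h1] at h2
    convert h2 using 2
    rw [← ValuationSubring.coe_subtype, map_sum]
    refine Finset.sum_congr rfl fun i _ => ?_
    rw [map_mul, map_pow, Algebra.smul_def, ← hc]
    rfl
  have halg : IsIntegral (ZMod ℓ) (IsLocalRing.residue _ x) := by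
    rw [← isAlgebraic_iff_isIntegral]
    exact ⟨g, hg, hroot⟩
  have hfd := IntermediateField.adjoin.finiteDimensional halg
  set K := IntermediateField.adjoin (ZMod ℓ) {IsLocalRing.residue (IntegerRing ℓ) x}
  have : Finite K := Module.finite_of_finite (ZMod ℓ)
  have := Fintype.ofFinite K
  refine ⟨Module.finrank (ZMod ℓ) K, Module.finrank_pos.ne', ?_⟩
  have h1 := FiniteField.pow_card
    (⟨_, IntermediateField.mem_adjoin_simple_self (ZMod ℓ) (IsLocalRing.residue _ x)⟩ : K)
  rw [Module.card_eq_pow_finrank (K := ZMod ℓ) (V := K), ZMod.card] at h1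
  exact congrArg Subtype.val h1

/-- The value `h x` depends only on the coset of `h` modulo the open subgroup fixing `ℚ_ℓ(x)`. Any
condition on it is therefore open, and also closed. -/
lemma isOpen_setOf_apply_mem (x : PadicAlgCl ℓ) (S : Set (PadicAlgCl ℓ)) :
    IsOpen {h : GLoc ℓ | h x ∈ S} := by
  rw [isOpen_iff_mem_nhds]
  intro h hh
  have hfd : FiniteDimensional ℚ_[ℓ] (IntermediateField.adjoin ℚ_[ℓ] {x}) :=
    IntermediateField.adjoin.finiteDimensional (Algebra.IsIntegral.isIntegral x)
  have hU := IntermediateField.fixingSubgroup_isOpen (IntermediateField.adjoin ℚ_[ℓ] {x})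
  refine Filter.mem_of_superset ((hU.preimage (continuous_const_mul h⁻¹)).mem_nhds (x := h) ?_) ?_
  · rw [Set.mem_preimage, inv_mul_cancel]
    exact one_mem _
  · intro g hg
    have h1 := (IntermediateField.mem_fixingSubgroup_iff _ _).1 hg x
      (IntermediateField.mem_adjoin_simple_self _ x)
    have h2 : g x = h x := by
      have h3 : h ((h⁻¹ * g) x) = h x := congrArg h h1
      rwa [← AlgEquiv.mul_apply, mul_inv_cancel_left] at h3
    change g x ∈ S
    rwa [h2]

lemma IsFrobenius.galRes_pow {σ : GLoc ℓ} (hσ : IsFrobenius σ) (m : ℕ) (x : ResidueFld ℓ) :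
    galRes (σ ^ m) x = x ^ ℓ ^ m := by
  obtain ⟨x, rfl⟩ := IsLocalRing.residue_surjective x
  induction m generalizing x with
  | zero =>
    rw [pow_zero, pow_zero, pow_one]
    rfl
  | succ m ih =>
    have h1 : galInt (σ ^ (m + 1)) x = galInt (σ ^ m) (galInt σ x) := by
      apply Subtype.ext
      rw [pow_succ]
      rfl
    have h2 : IsLocalRing.residue _ (galInt σ x) = IsLocalRing.residue _ x ^ ℓ := by
      rw [← map_pow, residue_eq_iff]
      exact hσ x (mem_integerRing.1 x.2)
    rw [galRes_residue, h1, ← galRes_residue, ih, h2, ← pow_mul, pow_succ']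

/-- A closed subgroup that contains inertia and a Frobenius element is the whole group. -/
lemma IsFrobenius.eq_top_of_isClosed {σ : GLoc ℓ} (hσ : IsFrobenius σ) {H : Subgroup (GLoc ℓ)}
    (hH : IsClosed (H : Set (GLoc ℓ))) (hI : inertia ℓ ≤ H) (hσH : σ ∈ H) : H = ⊤ := by
  refine (Subgroup.eq_top_iff' H).2 fun g => ?_
  -- Elements of `H` that act like `g` on the residue subfield fixed by `x ↦ x ^ ℓ ^ N!`. The
  -- factorials make these subfields nested and exhaustive. A point common to all `t N` differs from
  -- `g` by inertia, and compactness provides one.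
  let t : ℕ → Set (GLoc ℓ) := fun N => {h | h ∈ H ∧ ∀ x : IntegerRing ℓ,
    IsLocalRing.residue _ x ^ ℓ ^ N.factorial = IsLocalRing.residue _ x →
      IsLocalRing.residue _ (galInt h x) = IsLocalRing.residue _ (galInt g x)}
  have hcl : ∀ N, IsClosed (t N) := by
    intro N
    simp only [t, Set.ofPred_and, Set.ofPred_forall]
    refine hH.inter (isClosed_iInter fun x => isClosed_iInter fun _ => ?_)
    rw [← isOpen_compl_iff]
    have := isOpen_setOf_apply_mem (x : PadicAlgCl ℓ) {y | ¬ ‖y - g x‖ < 1}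
    convert this using 1
    ext h
    rw [Set.mem_compl_iff, Set.mem_ofPred_eq, residue_eq_iff]
    rfl
  have hdec : ∀ N, t (N + 1) ⊆ t N := by
    rintro N h ⟨h1, h2⟩
    refine ⟨h1, fun x hx => h2 x ?_⟩
    rw [Nat.factorial_succ, mul_comm]
    exact pow_pow_mul_eq_self hx _
  have hne : ∀ N, (t N).Nonempty := by
    intro N
    obtain ⟨m, hm⟩ := exists_eq_pow_of_pow_eq (q := ℓ) (galRes g) (Nat.factorial_ne_zero N)
    refine ⟨σ ^ m, pow_mem hσH m, fun x hx => ?_⟩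
    rw [← galRes_residue, ← galRes_residue, hm _ hx, hσ.galRes_pow]
  obtain ⟨h, hh⟩ := IsCompact.nonempty_iInter_of_sequence_nonempty_isCompact_isClosed t hdec hne
    (hcl 0).isCompact hcl
  rw [Set.mem_iInter] at hh
  have hinert : h⁻¹ * g ∈ inertia ℓ := by
    intro x hx
    obtain ⟨N, hN, hxN⟩ := exists_pow_eq_self (IsLocalRing.residue _ ⟨x, mem_integerRing.2 hx⟩)
    have h1 := (hh N).2 ⟨x, mem_integerRing.2 hx⟩ (by
      obtain ⟨d, hd⟩ := Nat.dvd_factorial (Nat.pos_of_ne_zero hN) le_rfl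
      rw [hd]
      exact pow_pow_mul_eq_self hxN _)
    rw [residue_eq_iff] at h1
    have h2 : h ((h⁻¹ * g) x - x) = g x - h x := by
      rw [map_sub, ← AlgEquiv.mul_apply, mul_inv_cancel_left]
    rw [← norm_gal h, h2, norm_sub_rev]
    exact h1
  have := H.mul_mem (hh 0).1 (hI hinert)
  rwa [mul_inv_cancel_left] at this

end Residue

/-! ### The cyclotomic character on the decomposition group -/

section CyclotomicLocal

variable {p : ℕ} [Fact p.Prime] {ℓ : ℕ} [Fact ℓ.Prime]

lemma norm_natCast_eq_one {q : ℕ} (h : ¬ ℓ ∣ q) : ‖(q : PadicAlgCl ℓ)‖ = 1 := by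
  have h1 := PadicAlgCl.norm_extends ℓ (q : ℚ_[ℓ])
  rw [map_natCast] at h1
  rw [h1]
  have h2 : ‖((q : ℤ) : ℚ_[ℓ])‖ = 1 := by
    refine le_antisymm (Padic.norm_int_le_one _) (not_lt.1 fun h3 => h ?_)
    exact_mod_cast (Padic.norm_intCast_lt_one_iff).1 h3
  exact_mod_cast h2

/-- Roots of unity of order prime to `ℓ` stay distinct in the residue field. If `ω ≠ 1`, the powers
of `ω` sum to zero, so `q` is minus the sum of the `ω ^ i - 1`. It would then have norm less than
one. -/
lemma eq_one_of_pow_eq_one {q : ℕ} (hq : ¬ ℓ ∣ q) {ω : PadicAlgCl ℓ} (h1 : ω ^ q = 1)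
    (h2 : ‖ω - 1‖ < 1) : ω = 1 := by
  have hω : ‖ω‖ ≤ 1 := by
    have h3 : ‖(ω - 1) + 1‖ ≤ max ‖ω - 1‖ ‖(1 : PadicAlgCl ℓ)‖ :=
      IsUltrametricDist.norm_add_le_max _ _
    rw [sub_add_cancel, norm_one, max_eq_right h2.le] at h3
    exact h3
  have hpow : ∀ i : ℕ, ‖ω ^ i - 1‖ < 1 := by
    intro i
    rw [← mul_geom_sum, norm_mul]
    refine mul_lt_one_of_nonneg_of_lt_one_left (norm_nonneg _) h2 ?_
    refine IsUltrametricDist.norm_sum_le_of_forall_le_of_nonneg zero_le_one fun j _ => ?_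
    rw [norm_pow]
    exact pow_le_one₀ (norm_nonneg _) hω
  by_contra hne
  have h3 : ∑ i ∈ Finset.range q, ω ^ i = 0 := by
    have := mul_geom_sum ω q
    rw [h1, sub_self, mul_eq_zero] at this
    exact this.resolve_left (sub_ne_zero.2 hne)
  have h4 : (q : PadicAlgCl ℓ) = - ∑ i ∈ Finset.range q, (ω ^ i - 1) := by
    rw [Finset.sum_sub_distrib, h3]
    simp
  have h5 := norm_natCast_eq_one hq
  rw [h4, norm_neg] at h5
  have hq0 : (Finset.range q).Nonempty := by
    rw [Finset.nonempty_range_iff]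
    rintro rfl
    exact hq (dvd_zero _)
  obtain ⟨i, -, hi⟩ := IsUltrametricDist.exists_norm_finsetSum_le_of_nonempty hq0
    (fun i => ω ^ i - 1)
  rw [h5] at hi
  exact (hpow i).not_ge hi

/-- If `s` acts on the residue field of `ℚ̄_ℓ` as `x ↦ x ^ m`, then `χ(s) = m`. -/
lemma chi_res_eq (hℓ : ℓ ≠ p) (ι : Qbar →ₐ[ℚ] PadicAlgCl ℓ) {s : GLoc ℓ} {m : ℕ}
    (hs : ∀ x : PadicAlgCl ℓ, ‖x‖ ≤ 1 → ‖s x - x ^ m‖ < 1) :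
    (chi p (res ι s) : ℤ_[p]) = m := by
  refine PadicInt.ext_of_toZModPow.1 fun n => ?_
  obtain ⟨ζ, hζ⟩ := HasEnoughRootsOfUnity.exists_primitiveRoot Qbar (p ^ n)
  have h1 : res ι s ζ = ζ ^ (PadicInt.toZModPow n (chi p (res ι s) : ℤ_[p])).val :=
    cyclotomicCharacter.spec p (MulSemiringAction.toRingAut GQ Qbar (res ι s)) ζ hζ.pow_eq_one
  set a := PadicInt.toZModPow n (chi p (res ι s) : ℤ_[p])
  have hη : IsPrimitiveRoot (ι ζ) (p ^ n) := hζ.map_of_injective ι.injective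
  set η := ι ζ
  have hpn : p ^ n ≠ 0 := pow_ne_zero _ (Fact.out : p.Prime).ne_zero
  have hη1 : ‖η‖ = 1 := by
    refine (pow_eq_one_iff_of_nonneg (norm_nonneg η) hpn).1 ?_
    rw [← norm_pow, hη.pow_eq_one, norm_one]
  have h2 : s η = η ^ a.val := by rw [← res_spec, h1, map_pow]
  have h3 := hs η hη1.le
  rw [h2] at h3
  have hη0 : η ^ m ≠ 0 := pow_ne_zero _ (hη.ne_zero hpn)
  -- `s` multiplies exponents of `η` by `a` exactly and by `m` modulo the maximal ideal. The ratio
  -- is thus a `p ^ n`-th root of unity congruent to `1`.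
  have h4 : η ^ a.val * (η ^ m)⁻¹ = 1 := by
    refine eq_one_of_pow_eq_one (q := p ^ n) (fun h => hℓ ?_) ?_ ?_
    · exact (Nat.prime_dvd_prime_iff_eq Fact.out Fact.out).1
        ((Fact.out : ℓ.Prime).dvd_of_dvd_pow h)
    · rw [mul_pow, inv_pow, ← pow_mul, ← pow_mul, mul_comm _ (p ^ n), mul_comm _ (p ^ n), pow_mul,
        pow_mul, hη.pow_eq_one]
      simp
    · have h5 : η ^ a.val * (η ^ m)⁻¹ - 1 = (η ^ a.val - η ^ m) * (η ^ m)⁻¹ := by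
        rw [sub_mul, mul_inv_cancel₀ hη0]
      rw [h5, norm_mul, norm_inv, norm_pow, hη1, one_pow, inv_one, mul_one]
      exact h3
  rw [mul_inv_eq_one₀ hη0] at h4
  have h5 : (hη.isUnit hpn).unit ^ a.val = (hη.isUnit hpn).unit ^ m := Units.ext h4
  rw [pow_eq_pow_iff_modEq, ← (hη.isUnit_unit hpn).eq_orderOf, ← ZMod.natCast_eq_natCast_iff,
    ZMod.natCast_zmod_val] at h5
  rw [h5, map_natCast]

lemma chi_res_inertia (hℓ : ℓ ≠ p) (ι : Qbar →ₐ[ℚ] PadicAlgCl ℓ) {s : GLoc ℓ}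
    (hs : s ∈ inertia ℓ) : chi p (res ι s) = 1 := by
  refine Units.ext ?_
  rw [chi_res_eq hℓ ι (m := 1) (fun x hx => by simpa using hs x hx)]
  simp

lemma continuous_chi : Continuous (chi p) := cyclotomicCharacter.continuous p ℚ Qbar

/-- A finite extension `E` of `ℚ` has finitely many generators. Fixing `E` after restriction
therefore amounts to finitely many open conditions on `s`. -/
lemma continuous_res (ι : Qbar →ₐ[ℚ] PadicAlgCl ℓ) : Continuous (res ι) := by
  refine continuous_of_continuousAt_one _ ?_
  rw [ContinuousAt, map_one, (galGroupBasis ℚ Qbar).nhds_one_hasBasis.tendsto_right_iff]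
  rintro _ ⟨_, ⟨E, hE, rfl⟩, rfl⟩
  have hE' : FiniteDimensional ℚ E := hE
  obtain ⟨S, hS⟩ := IntermediateField.essFiniteType_iff.1 (inferInstance : Algebra.EssFiniteType ℚ E)
  have h : ∀ x ∈ S, {s : GLoc ℓ | s (ι x) ∈ ({ι x} : Set (PadicAlgCl ℓ))} ∈ nhds (1 : GLoc ℓ) :=
    fun x _ => (isOpen_setOf_apply_mem (ι x) {ι x}).mem_nhds rfl
  filter_upwards [(Filter.biInter_finset_mem S).2 h] with s hs
  have hs' : ∀ x ∈ S, s (ι x) = ι x := fun x hx => Set.mem_iInter₂.1 hs x hx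
  have h1 : E ≤ IntermediateField.fixedField (Subgroup.zpowers (res ι s)) := by
    rw [← hS, IntermediateField.adjoin_le_iff]
    intro x hx
    refine (IntermediateField.mem_fixedField_iff _ _).2 ?_
    intro f hf
    have h2 : Subgroup.zpowers (res ι s) ≤ MulAction.stabilizer GQ x := by
      rw [Subgroup.zpowers_le]
      exact ι.injective ((res_spec ι s x).trans (hs' x hx))
    exact h2 hf
  exact (IntermediateField.mem_fixingSubgroup_iff _ _).2 fun y hy =>
    (IntermediateField.mem_fixedField_iff _ _).1 (h1 hy) _ (Subgroup.mem_zpowers _)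

/-- The cyclotomic `ℤ_p`-extension is unramified at `ℓ ≠ p`: each layer is fixed by the kernel of
`χ`, and `χ` is trivial on inertia. -/
lemma inertia_le_fixing_locField (hℓ : ℓ ≠ p) (ι : Qbar →ₐ[ℚ] PadicAlgCl ℓ) (n : ℕ) :
    inertia ℓ ≤ (locField ι (layer p n) 1).fixingSubgroup := by
  intro s hs
  rw [mem_fixing_locField]
  intro x hx
  rw [AlgEquiv.one_apply, ← res_spec]
  refine congrArg ι ((IntermediateField.mem_fixedField_iff _ _).1 hx _ ?_)
  simp [layerSubgroup, MonoidHom.mem_ker, chi_res_inertia hℓ ι hs]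

end CyclotomicLocal

/-! ### Unramified cocycles -/

section Unramified

variable {p : ℕ} [Fact p.Prime] {ℓ : ℕ} [Fact ℓ.Prime]
variable {M : Type} [AddCommGroup M] [Module ℤ_[p] M] [TopologicalSpace M]
  [IsTopologicalAddGroup M]

/-- The cocycle `z` on the whole decomposition group. -/
abbrev evalAt {θ : Representation ℤ_[p] (GLoc ℓ) M}
    (z : Z1 (θ.comp (⊥ : IntermediateField ℚ_[ℓ] (PadicAlgCl ℓ)).fixingSubgroup.subtype))
    (s : GLoc ℓ) : M := z.1 ⟨s, mem_fixing_bot s⟩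

variable {θ : Representation ℤ_[p] (GLoc ℓ) M}

lemma evalAt_mul
    (z : Z1 (θ.comp (⊥ : IntermediateField ℚ_[ℓ] (PadicAlgCl ℓ)).fixingSubgroup.subtype))
    (s t : GLoc ℓ) : evalAt z (s * t) = evalAt z s + θ s (evalAt z t) :=
  z.2.2 ⟨s, mem_fixing_bot s⟩ ⟨t, mem_fixing_bot t⟩

lemma evalAt_one
    (z : Z1 (θ.comp (⊥ : IntermediateField ℚ_[ℓ] (PadicAlgCl ℓ)).fixingSubgroup.subtype)) :
    evalAt z 1 = 0 := by
  have := evalAt_mul z 1 1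
  simpa using this

lemma continuous_evalAt
    (z : Z1 (θ.comp (⊥ : IntermediateField ℚ_[ℓ] (PadicAlgCl ℓ)).fixingSubgroup.subtype)) :
    Continuous (evalAt z) :=
  z.2.1.comp (continuous_id.subtype_mk _)

/-- The cocycle on the decomposition group given by a function. -/
def Z1.ofFun (f : GLoc ℓ → M) (hf : Continuous f) (h : ∀ s t, f (s * t) = f s + θ s (f t)) :
    Z1 (θ.comp (⊥ : IntermediateField ℚ_[ℓ] (PadicAlgCl ℓ)).fixingSubgroup.subtype) :=
  ⟨fun s => f s, hf.comp continuous_subtype_val, fun s t => h s t⟩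

/-- A cocycle that vanishes on inertia and at a Frobenius element is zero. -/
lemma Z1.eq_zero {σ : GLoc ℓ} (hσ : IsFrobenius σ) (hM : IsClosed ({0} : Set M))
    (z : Z1 (θ.comp (⊥ : IntermediateField ℚ_[ℓ] (PadicAlgCl ℓ)).fixingSubgroup.subtype))
    (hI : ∀ s ∈ inertia ℓ, evalAt z s = 0) (hz : evalAt z σ = 0) : z = 0 := by
  let H : Subgroup (GLoc ℓ) :=
    { carrier := {s | evalAt z s = 0}
      one_mem' := evalAt_one z
      mul_mem' := fun {a b} ha hb => by
        change evalAt z (a * b) = 0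
        rw [evalAt_mul z, show evalAt z a = 0 from ha, show evalAt z b = 0 from hb, map_zero, add_zero]
      inv_mem' := fun {a} ha => by
        have h1 := evalAt_mul z a⁻¹ a
        rw [inv_mul_cancel, evalAt_one z, show evalAt z a = 0 from ha, map_zero, add_zero] at h1
        exact h1.symm }
  have hH : H = ⊤ := hσ.eq_top_of_isClosed (hM.preimage (continuous_evalAt z)) hI hz
  refine Subtype.ext (funext fun s => ?_)
  have : s.1 ∈ H := hH ▸ Subgroup.mem_top _
  exact this

/-- Inertia is normal. Expanding `z (s t)` both as written and as `z (t · t⁻¹ s t)` shows that the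
values of a cocycle killed by inertia lie in the inertia invariants. -/
lemma evalAt_fixed
    (z : Z1 (θ.comp (⊥ : IntermediateField ℚ_[ℓ] (PadicAlgCl ℓ)).fixingSubgroup.subtype))
    (hI : ∀ s ∈ inertia ℓ, evalAt z s = 0) (t : GLoc ℓ) {s : GLoc ℓ} (hs : s ∈ inertia ℓ) :
    θ s (evalAt z t) = evalAt z t := by
  have h1 := evalAt_mul z s t
  have h2 := evalAt_mul z t (t⁻¹ * s * t)
  rw [hI _ (conj_mem_inertia t hs), map_zero, add_zero, mul_assoc, mul_inv_cancel_left, h1,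
    hI s hs, zero_add] at h2
  exact h2

/-- The coboundary of `x`. -/
def Z1.cob (hθ : ∀ x, Continuous fun s => θ s x) (x : M) :
    Z1 (θ.comp (⊥ : IntermediateField ℚ_[ℓ] (PadicAlgCl ℓ)).fixingSubgroup.subtype) :=
  Z1.ofFun (fun s => θ s x - x) ((hθ x).sub continuous_const) fun s t => by
    simp only [map_mul, Module.End.mul_apply, map_sub]
    abel

lemma H1.mk_cob (hθ : ∀ x, Continuous fun s => θ s x) (x : M) : H1.mk _ (Z1.cob hθ x) = 0 :=
  H1.mk_eq_zero.2 ⟨x, fun _ => rfl⟩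

/-- An unramified class is represented by a cocycle that vanishes on inertia. -/
lemma exists_of_mem_H1nr (hθ : ∀ x, Continuous fun s => θ s x) {c : H1Field θ ⊥}
    (hc : c ∈ H1nr θ ⊥) :
    ∃ z, H1.mk _ z = c ∧ ∀ s ∈ inertia ℓ, evalAt z s = 0 := by
  obtain ⟨z, rfl⟩ := H1.mk_surjective _ c
  obtain ⟨x, hx⟩ := mem_H1nr_mk.1 hc
  refine ⟨z - Z1.cob hθ x, ?_, fun s hs => ?_⟩
  · rw [map_sub, H1.mk_cob, sub_zero]
  · exact sub_eq_zero.2 (hx s (mem_fixing_bot s) hs)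

/-- A class that vanishes on inertia is trivial when its value at Frobenius is `(σ - 1) a` with
`a` fixed by inertia. -/
lemma H1.mk_eq_zero_of_frobenius (hθ : ∀ x, Continuous fun s => θ s x) {σ : GLoc ℓ}
    (hσ : IsFrobenius σ) (hM : IsClosed ({0} : Set M))
    (z : Z1 (θ.comp (⊥ : IntermediateField ℚ_[ℓ] (PadicAlgCl ℓ)).fixingSubgroup.subtype))
    (hI : ∀ s ∈ inertia ℓ, evalAt z s = 0) {a : M} (ha : ∀ s ∈ inertia ℓ, θ s a = a)
    (hz : evalAt z σ = θ σ a - a) : H1.mk _ z = 0 := by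
  have h : z - Z1.cob hθ a = 0 := by
    refine Z1.eq_zero hσ hM _ (fun s hs => ?_) (sub_eq_zero.2 hz)
    refine sub_eq_zero.2 ((hI s hs).trans (sub_eq_zero.2 (ha s hs)).symm)
  rw [sub_eq_zero.1 h, H1.mk_cob]

/-- If every `b` fixed by inertia is `(σ - 1) a` with `a` fixed by inertia, then all unramified
classes are trivial. -/
lemma H1nr_eq_bot (hθ : ∀ x, Continuous fun s => θ s x) {σ : GLoc ℓ}
    (hσ : IsFrobenius σ) (hM : IsClosed ({0} : Set M))
    (h : ∀ b : M, (∀ s ∈ inertia ℓ, θ s b = b) →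
      ∃ a : M, (∀ s ∈ inertia ℓ, θ s a = a) ∧ θ σ a - a = b) : H1nr θ ⊥ = ⊥ := by
  refine (AddSubgroup.eq_bot_iff_forall _).2 fun c hc => ?_
  obtain ⟨z, rfl, hz⟩ := exists_of_mem_H1nr hθ hc
  obtain ⟨a, ha, hb⟩ := h (evalAt z σ) fun s hs => evalAt_fixed z hz σ hs
  exact H1.mk_eq_zero_of_frobenius hθ hσ hM z hz ha hb.symm

end Unramified

/-! ### The kernel of the restriction map -/

section Torsion

variable {A : Type} [AddCommGroup A] {q : ℕ} [Fact q.Prime]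

lemma rank_torsionBy_eq_zero (h : ∀ a : A, a = 0) :
    letI : Module (ZMod q) (AddSubgroup.torsionBy A (q : ℤ)) := AddSubgroup.torsionBy.zmodModule
    Module.rank (ZMod q) (AddSubgroup.torsionBy A (q : ℤ)) = 0 := by
  have : Subsingleton (AddSubgroup.torsionBy A (q : ℤ)) :=
    ⟨fun a b => Subtype.ext ((h a).trans (h b).symm)⟩
  let _ : Module (ZMod q) (AddSubgroup.torsionBy A (q : ℤ)) := AddSubgroup.torsionBy.zmodModule
  exact rank_subsingleton' _ _

lemma rank_torsionBy_eq_one (a₀ : A) (h0 : a₀ ≠ 0) (hq : q • a₀ = 0)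
    (h : ∀ a : A, ∃ m : ℕ, a = m • a₀) :
    letI : Module (ZMod q) (AddSubgroup.torsionBy A (q : ℤ)) := AddSubgroup.torsionBy.zmodModule
    Module.rank (ZMod q) (AddSubgroup.torsionBy A (q : ℤ)) = 1 := by
  let _ : Module (ZMod q) (AddSubgroup.torsionBy A (q : ℤ)) := AddSubgroup.torsionBy.zmodModule
  refine rank_eq_one_iff.2 ?_
  refine ⟨⟨a₀, ?_⟩, fun h1 => h0 (congrArg Subtype.val h1), ?_⟩
  · change (q : ℤ) • a₀ = 0
    rw [natCast_zsmul, hq]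
  · rintro ⟨a, ha⟩
    obtain ⟨m, hm⟩ := h a
    refine ⟨m, Subtype.ext ?_⟩
    rw [Nat.cast_smul_eq_nsmul]
    exact hm.symm

/-- Abstract form of the final count, meant for `N = H¹_f`, `K = H¹_nr` and `f = h`. When `N` is
trivial, `ker f` is a copy of `K`, here cyclic of order `q`. -/
lemma rank_torsionBy_ker_eq_one {B C : Type} [AddCommGroup B] [AddZeroClass C] {N : AddSubgroup B}
    (f : B ⧸ N →+ C) (hN : N = ⊥) {K : AddSubgroup B}
    (hK : ∀ b, f (QuotientAddGroup.mk' N b) = 0 ↔ b ∈ K) (b₀ : B) (hb₀ : b₀ ∈ K) (h0 : b₀ ≠ 0)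
    (hq : q • b₀ = 0) (h : ∀ b ∈ K, ∃ m : ℕ, b = m • b₀) :
    letI : Module (ZMod q) (AddSubgroup.torsionBy f.ker (q : ℤ)) :=
      AddSubgroup.torsionBy.zmodModule
    Module.rank (ZMod q) (AddSubgroup.torsionBy f.ker (q : ℤ)) = 1 := by
  refine rank_torsionBy_eq_one ⟨QuotientAddGroup.mk' N b₀, (hK b₀).2 hb₀⟩ (fun h1 => h0 ?_)
    (Subtype.ext ?_) ?_
  · have h2 := (QuotientAddGroup.eq_zero_iff _).1 (congrArg Subtype.val h1)
    rwa [hN, AddSubgroup.mem_bot] at h2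
  · rw [AddSubgroup.coe_nsmul, ← map_nsmul, hq, map_zero]
    rfl
  · rintro ⟨d, hd⟩
    obtain ⟨b, rfl⟩ := QuotientAddGroup.mk'_surjective _ d
    obtain ⟨m, hm⟩ := h b ((hK b).1 hd)
    refine ⟨m, Subtype.ext ?_⟩
    rw [AddSubgroup.coe_nsmul, ← map_nsmul, ← hm]

end Torsion

/-! ### Classes that become unramified over `ℚ_∞` -/

section Kernel

variable {p : ℕ} [Fact p.Prime] {ℓ : ℕ} [Fact ℓ.Prime]
variable {M : Type} [AddCommGroup M] [Module ℤ_[p] M] [TopologicalSpace M]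
  [IsTopologicalAddGroup M]

lemma resOn_self (θ : Representation ℤ_[p] (GLoc ℓ) M) {U : Subgroup (GLoc ℓ)} (h : U ≤ U)
    (c : H1On θ U) : resOn θ h c = c := by
  obtain ⟨z, rfl⟩ := H1.mk_surjective _ c
  rw [resOn, H1.map_mk]
  rfl

lemma resOn_resOn (θ : Representation ℤ_[p] (GLoc ℓ) M) {U U' U'' : Subgroup (GLoc ℓ)}
    (h : U' ≤ U) (h' : U'' ≤ U') (h'' : U'' ≤ U) (c : H1On θ U) :
    resOn θ h' (resOn θ h c) = resOn θ h'' c := by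
  obtain ⟨z, rfl⟩ := H1.mk_surjective _ c
  rw [resOn, resOn, resOn, H1.map_mk, H1.map_mk, H1.map_mk]
  rfl

lemma resQuot_self (ι : Qbar →ₐ[ℚ] PadicAlgCl ℓ) (φ : Representation ℤ_[p] GQ M)
    {K : IntermediateField ℚ Qbar} (h : K ≤ K) (g : GQ) (d : SingQuot ι φ K g) :
    resQuot ι φ h g d = d := by
  obtain ⟨c, rfl⟩ := QuotientAddGroup.mk'_surjective _ d
  rw [resQuot_mk, resOn_self]

lemma resQuot_resQuot (ι : Qbar →ₐ[ℚ] PadicAlgCl ℓ) (φ : Representation ℤ_[p] GQ M)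
    {K K' K'' : IntermediateField ℚ Qbar} (h : K ≤ K') (h' : K' ≤ K'') (h'' : K ≤ K'') (g : GQ)
    (d : SingQuot ι φ K g) :
    resQuot ι φ h' g (resQuot ι φ h g d) = resQuot ι φ h'' g d := by
  obtain ⟨c, rfl⟩ := QuotientAddGroup.mk'_surjective _ d
  rw [resQuot_mk, resQuot_mk, resQuot_mk, resOn_resOn]

lemma JGrRes_apply (ι : Qbar →ₐ[ℚ] PadicAlgCl ℓ) (φ : Representation ℤ_[p] GQ M)
    (hφ : ∀ g, Continuous (φ g)) {K K' : IntermediateField ℚ Qbar} (h : K ≤ K')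
    (x : JGr ι φ hφ K) (g : GQ) : (JGrRes ι φ hφ h x).1 g = resQuot ι φ h g (x.1 g) := rfl

/-- Functoriality of restriction makes an element of the limit vanish only if it already vanishes at
some finite layer. -/
lemma directedSystem_JGr (ι : Qbar →ₐ[ℚ] PadicAlgCl ℓ) (φ : Representation ℤ_[p] GQ M)
    (hφ : ∀ g, Continuous (φ g)) :
    DirectedSystem (fun n : ℕ => JGr ι φ hφ (layer p n))
      (fun _ _ h => JGrRes ι φ hφ (layer_mono p h)) where
  map_self n x := by
    refine Subtype.ext (funext fun g => ?_)
    rw [JGrRes_apply, resQuot_self]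
  map_map i j k hij hjk x := by
    refine Subtype.ext (funext fun g => ?_)
    rw [JGrRes_apply, JGrRes_apply, JGrRes_apply, resQuot_resQuot]

/-- A class over `ℚ_ℓ` becomes unramified over `ℚ_∞` if and only if it is unramified. -/
lemma toJGrInf_eq_zero_iff (hℓ : ℓ ≠ p) (ι : Qbar →ₐ[ℚ] PadicAlgCl ℓ)
    (φ : Representation ℤ_[p] GQ M) (hφ : ∀ g, Continuous (φ g))
    (c : H1Field (φ.comp (res ι)) ⊥) :
    toJGrInf ι φ hφ c = 0 ↔ c ∈ H1nr (φ.comp (res ι)) ⊥ := by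
  constructor
  · intro h
    have := directedSystem_JGr ι φ hφ
    rw [toJGrInf, AddMonoidHom.comp_apply] at h
    obtain ⟨n, hn, h0⟩ := AddCommGroup.DirectLimit.of.zero_exact _ _ h
    obtain ⟨z, rfl⟩ := H1.mk_surjective _ c
    -- The component at the embedding `ι` itself suffices: its local field is fixed by all of
    -- inertia, so the coboundary condition there covers the inertia group of `ℚ_ℓ`.
    have h1 := congrFun (congrArg Subtype.val h0) 1
    rw [JGrRes_apply] at h1
    have h2 : resOn _ (fixing_locField_anti ι (layer_mono p hn) 1)
        (toLoc ι φ hφ (layer p 0) 1 (H1.mk _ z)) ∈ H1nr _ _ :=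
      (QuotientAddGroup.eq_zero_iff _).1 h1
    rw [toLoc, H1.map_mk, resOn, H1.map_mk, mem_H1nr_mk] at h2
    obtain ⟨x, hx⟩ := h2
    refine mem_H1nr_mk.2 ⟨x, fun s hs hi => ?_⟩
    have h3 := hx s (inertia_le_fixing_locField hℓ ι n hi) hi
    rw [Z1.map_apply, Z1.map_apply, LinearMap.id_apply, localRep_apply, inv_one, map_one,
      one_mul, mul_one] at h3
    exact h3
  · intro h
    rw [toJGrInf, AddMonoidHom.comp_apply, toJGr_of_nr ι φ hφ _ h, map_zero]

namespace GaloisLattice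

lemma h_mk_eq_zero_iff (hℓ : ℓ ≠ p) (Λ : GaloisLattice p)
    (ι : Qbar →ₐ[ℚ] PadicAlgCl ℓ) (c : H1Field (Λ.repA.comp (res ι)) ⊥) :
    Λ.h ι (QuotientAddGroup.mk' _ c) = 0 ↔ c ∈ H1nr (Λ.repA.comp (res ι)) ⊥ := by
  rw [← toJGrInf_eq_zero_iff hℓ ι Λ.repA Λ.continuous_repA c]
  exact Iff.rfl

/-- `δ_ℓ = 0` when all unramified classes are trivial. -/
lemma delta_eq_zero (hℓ : ℓ ≠ p) (Λ : GaloisLattice p)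
    (ι : Qbar →ₐ[ℚ] PadicAlgCl ℓ) (h : H1nr (Λ.repA.comp (res ι)) ⊥ = ⊥) : Λ.delta ι = 0 := by
  refine rank_torsionBy_eq_zero ?_
  rintro ⟨d, hd⟩
  refine Subtype.ext ?_
  obtain ⟨c, rfl⟩ := QuotientAddGroup.mk'_surjective _ d
  have h1 := (Λ.h_mk_eq_zero_iff hℓ ι c).1 hd
  rw [h, AddSubgroup.mem_bot] at h1
  exact (congrArg (QuotientAddGroup.mk' (Λ.H1f ι)) h1).trans (map_zero (QuotientAddGroup.mk' (Λ.H1f ι)))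

/-- `δ_ℓ = 1` when `H¹_f = 0` and the unramified classes are the multiples of a class of
order `p`. -/
lemma delta_eq_one (hℓ : ℓ ≠ p) (Λ : GaloisLattice p)
    (ι : Qbar →ₐ[ℚ] PadicAlgCl ℓ) (hf : Λ.H1f ι = ⊥) (c₀ : H1Field (Λ.repA.comp (res ι)) ⊥)
    (hc₀ : c₀ ∈ H1nr (Λ.repA.comp (res ι)) ⊥) (hne : c₀ ≠ 0) (hp : p • c₀ = 0)
    (h : ∀ c ∈ H1nr (Λ.repA.comp (res ι)) ⊥, ∃ m : ℕ, c = m • c₀) : Λ.delta ι = 1 := by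
  exact rank_torsionBy_ker_eq_one (q := p) (Λ.h ι) hf (Λ.h_mk_eq_zero_iff hℓ ι) c₀ hc₀ hne hp h

end GaloisLattice

end Kernel

/-! ### Integral matrices acting on `ℚ_p²` -/

section Matrices

variable {p : ℕ} [Fact p.Prime]

/-- The action of integral matrices on `V = ℚ_p²`. -/
def act (X : Matrix (Fin 2) (Fin 2) ℤ_[p]) : Vsp p →ₗ[ℚ_[p]] Vsp p :=
  Matrix.toLin' (X.map (algebraMap ℤ_[p] ℚ_[p]))

lemma act_apply_zero (X : Matrix (Fin 2) (Fin 2) ℤ_[p]) (v : Vsp p) :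
    act X v 0 = (X 0 0 : ℚ_[p]) * v 0 + (X 0 1 : ℚ_[p]) * v 1 := by
  simp [act, Matrix.toLin'_apply, Matrix.mulVec, dotProduct, Fin.sum_univ_two]

lemma act_apply_one (X : Matrix (Fin 2) (Fin 2) ℤ_[p]) (v : Vsp p) :
    act X v 1 = (X 1 0 : ℚ_[p]) * v 0 + (X 1 1 : ℚ_[p]) * v 1 := by
  simp [act, Matrix.toLin'_apply, Matrix.mulVec, dotProduct, Fin.sum_univ_two]

lemma vsp_ext {v w : Vsp p} (h0 : v 0 = w 0) (h1 : v 1 = w 1) : v = w := by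
  ext i
  fin_cases i
  · exact h0
  · exact h1

lemma act_one (v : Vsp p) : act (1 : Matrix (Fin 2) (Fin 2) ℤ_[p]) v = v := by
  apply vsp_ext <;> simp [act_apply_zero, act_apply_one]

lemma act_mul (X Y : Matrix (Fin 2) (Fin 2) ℤ_[p]) (v : Vsp p) :
    act (X * Y) v = act X (act Y v) := by
  rw [act, act, act, Matrix.map_mul, Matrix.toLin'_mul, LinearMap.comp_apply]

lemma act_one_add_smul (c : ℤ_[p]) (Y : Matrix (Fin 2) (Fin 2) ℤ_[p]) (v : Vsp p) :
    act (1 + c • Y) v = v + (c : ℚ_[p]) • act Y v := by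
  apply vsp_ext <;> simp [act_apply_zero, act_apply_one] <;> ring

lemma act_smul_matrix (c : ℤ_[p]) (Y : Matrix (Fin 2) (Fin 2) ℤ_[p]) (v : Vsp p) :
    act (c • Y) v = (c : ℚ_[p]) • act Y v := by
  apply vsp_ext <;> simp [act_apply_zero, act_apply_one] <;> ring

lemma act_inv_act (C : GL (Fin 2) ℤ_[p]) (v : Vsp p) :
    act (C⁻¹ : GL (Fin 2) ℤ_[p]).1 (act C.1 v) = v := by
  rw [← act_mul, ← Units.val_mul, inv_mul_cancel, Units.val_one, act_one]

lemma act_act_inv (C : GL (Fin 2) ℤ_[p]) (v : Vsp p) :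
    act C.1 (act (C⁻¹ : GL (Fin 2) ℤ_[p]).1 v) = v := by
  rw [← act_mul, ← Units.val_mul, mul_inv_cancel, Units.val_one, act_one]

lemma act_conj {C A : GL (Fin 2) ℤ_[p]} {X : Matrix (Fin 2) (Fin 2) ℤ_[p]}
    (h : ((C * A * C⁻¹ : GL (Fin 2) ℤ_[p]) : Matrix (Fin 2) (Fin 2) ℤ_[p]) = X) (v : Vsp p) :
    act C.1 (act A.1 v) = act X (act C.1 v) := by
  rw [← h, Units.val_mul, Units.val_mul, act_mul, act_mul, act_inv_act]

/-- Membership in the lattice `{‖v 0‖ ≤ r, ‖v 1‖ ≤ 1}`. -/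
def InLat (r : ℝ) (v : Vsp p) : Prop := ‖v 0‖ ≤ r ∧ ‖v 1‖ ≤ 1

lemma InLat.zero {r : ℝ} (hr : 0 ≤ r) : InLat r (0 : Vsp p) := by simp [InLat, hr]

lemma InLat.add {r : ℝ} {v w : Vsp p} (hv : InLat r v) (hw : InLat r w) : InLat r (v + w) :=
  ⟨(IsUltrametricDist.norm_add_le_max _ _).trans (max_le hv.1 hw.1),
    (IsUltrametricDist.norm_add_le_max _ _).trans (max_le hv.2 hw.2)⟩

lemma InLat.neg {r : ℝ} {v : Vsp p} (hv : InLat r v) : InLat r (-v) := by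
  simpa [InLat] using hv

lemma InLat.sub {r : ℝ} {v w : Vsp p} (hv : InLat r v) (hw : InLat r w) : InLat r (v - w) := by
  rw [sub_eq_add_neg]
  exact hv.add hw.neg

lemma InLat.smul {r : ℝ} {v : Vsp p} (hv : InLat r v) {c : ℚ_[p]} (hc : ‖c‖ ≤ 1) :
    InLat r (c • v) := by
  constructor
  · rw [Pi.smul_apply, smul_eq_mul, norm_mul]
    exact (mul_le_of_le_one_left (norm_nonneg _) hc).trans hv.1
  · rw [Pi.smul_apply, smul_eq_mul, norm_mul]
    exact (mul_le_of_le_one_left (norm_nonneg _) hc).trans hv.2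

lemma InLat.mono {r r' : ℝ} (h : r ≤ r') {v : Vsp p} (hv : InLat r v) : InLat r' v :=
  ⟨hv.1.trans h, hv.2⟩

lemma norm_coe_le_one (x : ℤ_[p]) : ‖(x : ℚ_[p])‖ ≤ 1 := x.2

lemma norm_le_inv_of_dvd {x : ℤ_[p]} (h : (p : ℤ_[p]) ∣ x) : ‖(x : ℚ_[p])‖ ≤ (p : ℝ)⁻¹ := by
  obtain ⟨y, rfl⟩ := h
  rw [PadicInt.coe_mul, norm_mul, PadicInt.coe_natCast, Padic.norm_p]
  exact mul_le_of_le_one_right (by positivity) (norm_coe_le_one y)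

/-- Matrices with lower left entry divisible by `p` preserve the lattices with `1 ≤ r ≤ p`. -/
lemma InLat.act {r : ℝ} (h1 : 1 ≤ r) (hp : r ≤ p) {X : Matrix (Fin 2) (Fin 2) ℤ_[p]}
    (hX : (p : ℤ_[p]) ∣ X 1 0) {v : Vsp p} (hv : InLat r v) : InLat r (act X v) := by
  have hp0 : (0 : ℝ) < p := by exact_mod_cast (Fact.out : p.Prime).pos
  constructor
  · rw [act_apply_zero]
    refine (IsUltrametricDist.norm_add_le_max _ _).trans (max_le ?_ ?_)
    · rw [norm_mul]
      exact (mul_le_of_le_one_left (norm_nonneg _) (norm_coe_le_one _)).trans hv.1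
    · rw [norm_mul]
      exact (mul_le_of_le_one_left (norm_nonneg _) (norm_coe_le_one _)).trans (hv.2.trans h1)
  · rw [act_apply_one]
    refine (IsUltrametricDist.norm_add_le_max _ _).trans (max_le ?_ ?_)
    · rw [norm_mul]
      calc ‖(X 1 0 : ℚ_[p])‖ * ‖v 0‖ ≤ (p : ℝ)⁻¹ * p :=
            mul_le_mul (norm_le_inv_of_dvd hX) (hv.1.trans hp) (norm_nonneg _) (by positivity)
        _ = 1 := inv_mul_cancel₀ hp0.ne'
    · rw [norm_mul]
      exact (mul_le_of_le_one_left (norm_nonneg _) (norm_coe_le_one _)).trans hv.2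

lemma InLat.act_one {v : Vsp p} (hv : InLat 1 v) (X : Matrix (Fin 2) (Fin 2) ℤ_[p]) :
    InLat 1 (TypeTwo.act X v) := by
  constructor
  · rw [act_apply_zero]
    refine (IsUltrametricDist.norm_add_le_max _ _).trans (max_le ?_ ?_)
    · rw [norm_mul]
      exact mul_le_one₀ (norm_coe_le_one _) (norm_nonneg _) hv.1
    · rw [norm_mul]
      exact mul_le_one₀ (norm_coe_le_one _) (norm_nonneg _) hv.2
  · rw [act_apply_one]
    refine (IsUltrametricDist.norm_add_le_max _ _).trans (max_le ?_ ?_)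
    · rw [norm_mul]
      exact mul_le_one₀ (norm_coe_le_one _) (norm_nonneg _) hv.1
    · rw [norm_mul]
      exact mul_le_one₀ (norm_coe_le_one _) (norm_nonneg _) hv.2

lemma toZMod_eq_zero_iff {x : ℤ_[p]} : PadicInt.toZMod x = 0 ↔ (p : ℤ_[p]) ∣ x := by
  rw [← RingHom.mem_ker, PadicInt.ker_toZMod, PadicInt.maximalIdeal_eq_span_p,
    Ideal.mem_span_singleton]

lemma toZModPow_eq_zero_iff {x : ℤ_[p]} {n : ℕ} :
    PadicInt.toZModPow n x = 0 ↔ (p : ℤ_[p]) ^ n ∣ x := by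
  rw [← RingHom.mem_ker, PadicInt.ker_toZModPow, Ideal.mem_span_singleton]

lemma exists_eq_one_add_smul {X : Matrix (Fin 2) (Fin 2) ℤ_[p]} {c : ℤ_[p]}
    (h : ∀ i j, c ∣ X i j - (1 : Matrix (Fin 2) (Fin 2) ℤ_[p]) i j) :
    ∃ Y : Matrix (Fin 2) (Fin 2) ℤ_[p], X = 1 + c • Y := by
  choose Y hY using h
  refine ⟨Matrix.of Y, ?_⟩
  ext1 i j
  rw [Matrix.add_apply, Matrix.smul_apply, Matrix.of_apply, smul_eq_mul, ← hY]
  ring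

lemma exists_of_redGL_eq_one {A : GL (Fin 2) ℤ_[p]} (h : redGL p A = 1) :
    ∃ Y : Matrix (Fin 2) (Fin 2) ℤ_[p], A.1 = 1 + (p : ℤ_[p]) • Y := by
  refine exists_eq_one_add_smul fun i j => ?_
  rw [← toZMod_eq_zero_iff, map_sub, sub_eq_zero]
  have h1 : PadicInt.toZMod (A.1 i j) = (1 : Matrix (Fin 2) (Fin 2) (ZMod p)) i j :=
    Matrix.ext_iff.2 (Units.ext_iff.1 h) i j
  rw [h1, Matrix.one_apply, Matrix.one_apply]
  split_ifs <;> simp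

lemma dvd_of_redGL_eq_one {A : GL (Fin 2) ℤ_[p]} (h : redGL p A = 1) :
    (p : ℤ_[p]) ∣ A.1 1 0 := by
  obtain ⟨Y, hY⟩ := exists_of_redGL_eq_one h
  exact ⟨Y 1 0, by simp [hY]⟩

/-- Lets integrality be tested in Type II coordinates. The range `1 ≤ r ≤ p` covers both lattices:
`r = 1` is `T` and `r = p` is `T'`. Both `C` and `C⁻¹` are congruent to `1` mod `p`, so both
preserve them. -/
lemma inLat_act_iff {r : ℝ} (h1 : 1 ≤ r) (hp : r ≤ p) {C : GL (Fin 2) ℤ_[p]}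
    (hC : redGL p C = 1) {v : Vsp p} : InLat r (act C.1 v) ↔ InLat r v := by
  refine ⟨fun h => ?_, fun h => h.act h1 hp (dvd_of_redGL_eq_one hC)⟩
  rw [← act_inv_act C v]
  exact h.act h1 hp (dvd_of_redGL_eq_one (by rw [map_inv, hC, inv_one]))

/-- If `A ≡ 1 mod p` then `A ^ (p ^ k) ≡ 1 mod p ^ k`. -/
lemma exists_pow_eq_one_add {A : GL (Fin 2) ℤ_[p]} (h : redGL p A = 1) (k : ℕ) :
    ∃ Y : Matrix (Fin 2) (Fin 2) ℤ_[p], (A ^ p ^ k).1 = 1 + ((p : ℤ_[p]) ^ k) • Y := by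
  obtain ⟨Y, hY⟩ := exists_of_redGL_eq_one h
  -- The lifting of congruences to `p`-power exponents is proved in the commutative ring `ℤ_p[X]`,
  -- then specialised at the matrix `Y`.
  have h1 : ((p : ℕ) : Polynomial ℤ_[p]) ∣ (1 + (p : Polynomial ℤ_[p]) * Polynomial.X) - 1 := ⟨Polynomial.X, by ring⟩
  obtain ⟨Q, hQ⟩ := dvd_sub_pow_of_dvd_sub h1 k
  rw [one_pow, sub_eq_iff_eq_add] at hQ
  have h2 := congrArg (Polynomial.aeval Y) hQ
  simp only [map_pow, map_add, map_mul, map_one, map_natCast, Polynomial.aeval_X] at h2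
  refine ⟨p * Polynomial.aeval Y Q, ?_⟩
  have h3 : ∀ (n : ℕ) (Z : Matrix (Fin 2) (Fin 2) ℤ_[p]),
      ((p : ℤ_[p]) ^ n) • Z = (p : Matrix (Fin 2) (Fin 2) ℤ_[p]) ^ n * Z := by
    intro n Z
    rw [← Nat.cast_pow, ← Nat.cast_pow, Nat.cast_smul_eq_nsmul, nsmul_eq_mul]
  have h4 := h3 1 Y
  rw [pow_one, pow_one] at h4
  rw [Units.val_pow_eq_pow_val, hY, h4, h2, h3, ← mul_assoc, ← pow_succ]
  abel

lemma exists_inLat_pow_smul (v : Vsp p) : ∃ k : ℕ, InLat 1 (((p : ℚ_[p]) ^ k) • v) := by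
  have hp1 : (1 : ℝ) < p := by exact_mod_cast (Fact.out : p.Prime).one_lt
  obtain ⟨k, hk⟩ := pow_unbounded_of_one_lt (max ‖v 0‖ ‖v 1‖) hp1
  have h1 : ∀ i, ‖v i‖ ≤ (p : ℝ) ^ k → ‖(((p : ℚ_[p]) ^ k) • v) i‖ ≤ 1 := by
    intro i hi
    rw [Pi.smul_apply, smul_eq_mul, norm_mul, norm_pow, Padic.norm_p, inv_pow, inv_mul_le_iff₀
      (by positivity), mul_one]
    exact hi
  exact ⟨k, h1 0 ((le_max_left _ _).trans hk.le), h1 1 ((le_max_right _ _).trans hk.le)⟩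

/-- The class of `v` modulo the standard lattice is killed by `p ^ k`, so a matrix congruent to `1`
mod `p ^ k` fixes it. -/
lemma inLat_act_pow_sub {A : GL (Fin 2) ℤ_[p]} {v : Vsp p} {k : ℕ}
    (hk : InLat 1 (((p : ℚ_[p]) ^ k) • v)) {Y : Matrix (Fin 2) (Fin 2) ℤ_[p]}
    (hY : A.1 = 1 + ((p : ℤ_[p]) ^ k) • Y) : InLat 1 (act A.1 v - v) := by
  rw [hY, act_one_add_smul, add_sub_cancel_left]
  have := hk.act_one Y
  rw [map_smul] at this
  simpa using this

end Matrices

/-! ### The action of inertia through a tame generator -/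

section Tame

variable {p : ℕ} [Fact p.Prime] {ℓ : ℕ} [Fact ℓ.Prime]

/-- The kernel of reduction modulo `p ^ k` on inertia. -/
def congruenceKer (ϱ : GLoc ℓ →* GL (Fin 2) ℤ_[p]) (k : ℕ) : Subgroup (inertia ℓ) :=
  ((Matrix.GeneralLinearGroup.map (n := Fin 2) (PadicInt.toZModPow (p := p) k)).comp
    (ϱ.comp (inertia ℓ).subtype)).ker

lemma mem_congruenceKer {ϱ : GLoc ℓ →* GL (Fin 2) ℤ_[p]} {k : ℕ} {s : inertia ℓ} :
    s ∈ congruenceKer ϱ k ↔ ∀ i j, (p : ℤ_[p]) ^ k ∣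
      (ϱ s).1 i j - (1 : Matrix (Fin 2) (Fin 2) ℤ_[p]) i j := by
  rw [congruenceKer, MonoidHom.mem_ker, Units.ext_iff, ← Matrix.ext_iff]
  refine forall₂_congr fun i j => ?_
  rw [← toZModPow_eq_zero_iff, map_sub, sub_eq_zero]
  have h : PadicInt.toZModPow k ((1 : Matrix (Fin 2) (Fin 2) ℤ_[p]) i j) =
      (1 : Matrix (Fin 2) (Fin 2) (ZMod (p ^ k))) i j := by
    rw [Matrix.one_apply, Matrix.one_apply]
    split_ifs <;> simp
  rw [h]
  exact Iff.rfl

lemma isOpen_congruenceKer {ϱ : GLoc ℓ →* GL (Fin 2) ℤ_[p]} (hϱ : Continuous ϱ) (k : ℕ) :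
    IsOpen (congruenceKer ϱ k : Set (inertia ℓ)) := by
  have h : (congruenceKer ϱ k : Set (inertia ℓ)) = ⋂ i, ⋂ j,
      (fun s : inertia ℓ => (ϱ s).1 i j) ⁻¹' Metric.closedBall
        ((1 : Matrix (Fin 2) (Fin 2) ℤ_[p]) i j) ((p : ℝ) ^ (-k : ℤ)) := by
    ext s
    simp only [SetLike.mem_coe, mem_congruenceKer, Set.mem_iInter, Set.mem_preimage,
      mem_closedBall_iff_norm, PadicInt.norm_le_pow_iff_mem_span_pow, Ideal.mem_span_singleton]
  rw [h]
  have hp : (p : ℝ) ≠ 0 := by exact_mod_cast (Fact.out : p.Prime).ne_zero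
  refine isOpen_iInter_of_finite fun i => isOpen_iInter_of_finite fun j => ?_
  refine (IsUltrametricDist.isOpen_closedBall _ (zpow_ne_zero _ hp)).preimage ?_
  exact (Units.continuous_val.comp (hϱ.comp continuous_subtype_val)).matrix_elem i j

/-- Residual triviality makes the image of inertia modulo `p ^ k` a `p`-group, since every element
is killed by `p ^ k`. This is what brings the tame generator into play. -/
lemma exists_index_congruenceKer {ϱ : GLoc ℓ →* GL (Fin 2) ℤ_[p]}
    (h1 : ∀ s, redGL p (ϱ s) = 1) (k : ℕ) : ∃ j : ℕ, (congruenceKer ϱ k).index = p ^ j := by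
  have : NeZero (p ^ k) := ⟨pow_ne_zero _ (Fact.out : p.Prime).ne_zero⟩
  rw [congruenceKer, Subgroup.index_ker]
  refine IsPGroup.iff_card.1 ?_
  rintro ⟨_, s, rfl⟩
  refine ⟨k, Subtype.ext ?_⟩
  change _ ^ p ^ k = 1
  rw [← map_pow]
  obtain ⟨Y, hY⟩ := exists_pow_eq_one_add (h1 s) k
  refine mem_congruenceKer.2 fun i j => ?_
  have h2 : (ϱ (s ^ p ^ k : inertia ℓ)).1 = (ϱ s ^ p ^ k).1 := by
    rw [Subgroup.coe_pow, map_pow]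
  rw [h2, hY]
  exact ⟨Y i j, by simp⟩

/-- The stabiliser of the class of `v` modulo a lattice. -/
def latStab (ϱ : GLoc ℓ →* GL (Fin 2) ℤ_[p]) (h1 : ∀ s, redGL p (ϱ s) = 1) {r : ℝ} (hr : 1 ≤ r)
    (hp : r ≤ p) (v : Vsp p) : Subgroup (GLoc ℓ) where
  carrier := {s | InLat r (act (ϱ s).1 v - v)}
  one_mem' := by
    change InLat r (act (ϱ 1).1 v - v)
    rw [map_one, Units.val_one, act_one, sub_self]
    exact InLat.zero (zero_le_one.trans hr)
  mul_mem' := fun {a b} ha hb => by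
    have e : act (ϱ (a * b)).1 v - v =
        act (ϱ a).1 (act (ϱ b).1 v - v) + (act (ϱ a).1 v - v) := by
      rw [map_mul, Units.val_mul, act_mul, map_sub]
      abel
    change InLat r (act (ϱ (a * b)).1 v - v)
    rw [e]
    exact (InLat.act hr hp (dvd_of_redGL_eq_one (h1 a)) hb).add ha
  inv_mem' := fun {a} ha => by
    have e : act (ϱ a⁻¹).1 v - v = - act (ϱ a⁻¹).1 (act (ϱ a).1 v - v) := by
      rw [map_inv, map_sub, act_inv_act]
      abel
    change InLat r (act (ϱ a⁻¹).1 v - v)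
    rw [e]
    exact (InLat.act hr hp (dvd_of_redGL_eq_one (h1 _)) ha).neg

lemma mem_latStab {ϱ : GLoc ℓ →* GL (Fin 2) ℤ_[p]} {h1 : ∀ s, redGL p (ϱ s) = 1} {r : ℝ}
    {hr : 1 ≤ r} {hp : r ≤ p} {v : Vsp p} {s : GLoc ℓ} :
    s ∈ latStab ϱ h1 hr hp v ↔ InLat r (act (ϱ s).1 v - v) := Iff.rfl

/-- A residually trivial representation of inertia is determined, as far as fixed vectors modulo
a lattice are concerned, by a tame generator. -/
lemma inLat_act_sub_of_tame {ϱ : GLoc ℓ →* GL (Fin 2) ℤ_[p]} (hϱ : Continuous ϱ)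
    (h1 : ∀ s, redGL p (ϱ s) = 1) {τ : inertia ℓ} (hτ : IsTameGenerator p τ)
    {r : ℝ} (hr : 1 ≤ r) (hp : r ≤ p) {v : Vsp p} (hv : InLat r (act (ϱ τ).1 v - v))
    {s : GLoc ℓ} (hs : s ∈ inertia ℓ) : InLat r (act (ϱ s).1 v - v) := by
  -- With `p ^ k v` integral, the congruence kernel of level `k` stabilises the class of `v`. It is
  -- open, normal and of `p`-power index, so together with `τ` it generates inertia.
  obtain ⟨k, hk⟩ := exists_inLat_pow_smul v
  have hN : congruenceKer ϱ k ≤ (latStab ϱ h1 hr hp v).subgroupOf (inertia ℓ) := fun s hs => by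
    obtain ⟨Y, hY⟩ := exists_eq_one_add_smul (mem_congruenceKer.1 hs)
    rw [Subgroup.mem_subgroupOf, mem_latStab]
    exact (inLat_act_pow_sub hk hY).mono hr
  have hS : Subgroup.zpowers τ ⊔ congruenceKer ϱ k ≤
      (latStab ϱ h1 hr hp v).subgroupOf (inertia ℓ) := by
    refine sup_le ?_ hN
    rw [Subgroup.zpowers_le, Subgroup.mem_subgroupOf, mem_latStab]
    exact hv
  have hnormal : (congruenceKer ϱ k).Normal := MonoidHom.normal_ker _
  rw [hτ (congruenceKer ϱ k) hnormal (isOpen_congruenceKer hϱ k)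
    (exists_index_congruenceKer h1 k)] at hS
  have hs' := hS (Subgroup.mem_top ⟨s, hs⟩)
  rwa [Subgroup.mem_subgroupOf, mem_latStab] at hs'

end Tame

/-! ### The twisted representation and its lattices -/

section TwistedLattices

variable {p : ℕ} [Fact p.Prime]

lemma act_twist (ρ : GQ →* GL (Fin 2) ℤ_[p]) (ψ : GQ →* ℤ_[p]ˣ) (g : GQ) (v : Vsp p) :
    act (twist ρ ψ g) v = ((ψ g : ℤ_[p]) : ℚ_[p]) • act (ρ g).1 v :=
  act_smul_matrix _ _ v

lemma mem_latticeT {ρ : GQ →* GL (Fin 2) ℤ_[p]} {ψ : GQ →* ℤ_[p]ˣ} {v : Vsp p} :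
    v ∈ (latticeT ρ ψ).lattice ↔ InLat 1 v := by
  rw [latticeT, Submodule.mem_span_pair]
  constructor
  · rintro ⟨a, b, rfl⟩
    constructor
    · simp [Algebra.smul_def]
      exact a.2
    · simp [Algebra.smul_def]
      exact b.2
  · rintro ⟨h0, h1⟩
    obtain ⟨a, ha⟩ : ∃ a : ℤ_[p], (a : ℚ_[p]) = v 0 := ⟨⟨_, h0⟩, rfl⟩
    obtain ⟨b, hb⟩ : ∃ b : ℤ_[p], (b : ℚ_[p]) = v 1 := ⟨⟨_, h1⟩, rfl⟩
    refine ⟨a, b, vsp_ext ?_ ?_⟩ <;> simp [Algebra.smul_def, ha, hb]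

lemma mem_latticeT' {ρ : GQ →* GL (Fin 2) ℤ_[p]} {ψ : GQ →* ℤ_[p]ˣ}
    {hρ : ∀ g, (p : ℤ_[p]) ∣ ρ g 1 0} {v : Vsp p} :
    v ∈ (latticeT' ρ ψ hρ).lattice ↔ InLat p v := by
  have hp0 : (0 : ℝ) < p := by exact_mod_cast (Fact.out : p.Prime).pos
  have hp : (p : ℚ_[p]) ≠ 0 := Nat.cast_ne_zero.2 (Fact.out : p.Prime).ne_zero
  rw [latticeT', Submodule.mem_span_pair]
  constructor
  · rintro ⟨a, b, rfl⟩
    constructor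
    · simp [Algebra.smul_def]
      exact mul_le_of_le_one_left hp0.le a.2
    · simp [Algebra.smul_def]
      exact b.2
  · rintro ⟨h0, h1⟩
    have h2 : ‖(p : ℚ_[p]) * v 0‖ ≤ 1 := by
      rw [norm_mul, Padic.norm_p, inv_mul_le_iff₀ hp0, mul_one]
      exact h0
    obtain ⟨a, ha⟩ : ∃ a : ℤ_[p], (a : ℚ_[p]) = p * v 0 := ⟨⟨_, h2⟩, rfl⟩
    obtain ⟨b, hb⟩ : ∃ b : ℤ_[p], (b : ℚ_[p]) = v 1 := ⟨⟨_, h1⟩, rfl⟩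
    refine ⟨a, b, vsp_ext ?_ ?_⟩
    · simp [Algebra.smul_def, ha]
      field_simp
    · simp [Algebra.smul_def, hb]

lemma isClosed_setOf_inLat (r : ℝ) : IsClosed {v : Vsp p | InLat r v} :=
  (isClosed_le (continuous_apply 0).norm continuous_const).inter
    (isClosed_le (continuous_apply 1).norm continuous_const)

lemma continuous_teichLift {β : GQ →* (ZMod p)ˣ} (hβ : Continuous β) :
    Continuous (teichLift β) := by
  rw [teichLift, MonoidHom.coe_comp]
  exact (continuous_of_discreteTopology (α := (ZMod p)ˣ)).comp hβ

lemma continuous_twist {ρ : GQ →* GL (Fin 2) ℤ_[p]} {ψ : GQ →* ℤ_[p]ˣ} (hρ : Continuous ρ)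
    (hψ : Continuous ψ) : Continuous (twist ρ ψ) :=
  (Units.continuous_val.comp hψ).smul (Units.continuous_val.comp hρ)

lemma continuous_act {X : Type*} [TopologicalSpace X] {f : X → Matrix (Fin 2) (Fin 2) ℤ_[p]}
    (hf : Continuous f) (v : Vsp p) : Continuous fun x => act (f x) v := by
  have h : ∀ i j, Continuous fun x => ((f x i j : ℤ_[p]) : ℚ_[p]) := fun i j =>
    continuous_subtype_val.comp (hf.matrix_elem i j)
  refine continuous_pi fun i => ?_
  fin_cases i
  · simp only [Fin.zero_eta, act_apply_zero]
    exact ((h 0 0).mul continuous_const).add ((h 0 1).mul continuous_const)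
  · simp only [Fin.mk_one, act_apply_one]
    exact ((h 1 0).mul continuous_const).add ((h 1 1).mul continuous_const)

variable {ℓ : ℕ} [Fact ℓ.Prime]

lemma GaloisLattice.repA_mkQ (Λ : GaloisLattice p) (ι : Qbar →ₐ[ℚ] PadicAlgCl ℓ) (s : GLoc ℓ)
    (v : Vsp p) : (Λ.repA.comp (res ι)) s (Λ.lattice.mkQ v) =
      Λ.lattice.mkQ (Λ.rep (res ι s) v) := rfl

lemma GaloisLattice.mkQ_eq_iff (Λ : GaloisLattice p) {v w : Vsp p} :
    Λ.lattice.mkQ v = Λ.lattice.mkQ w ↔ v - w ∈ Λ.lattice :=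
  Submodule.Quotient.eq _

lemma GaloisLattice.isClosed_zero (Λ : GaloisLattice p)
    (h : IsClosed (Λ.lattice : Set (Vsp p))) : IsClosed ({0} : Set Λ.A) := by
  have hq : Topology.IsQuotientMap Λ.lattice.mkQ := isQuotientMap_quot_mk
  rw [← hq.isClosed_preimage]
  convert h using 1
  ext v
  exact Submodule.Quotient.mk_eq_zero _

lemma GaloisLattice.continuous_repV_apply (Λ : GaloisLattice p) (ι : Qbar →ₐ[ℚ] PadicAlgCl ℓ)
    (h : ∀ v, Continuous fun g => Λ.rep g v) (v : Vsp p) :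
    Continuous fun s => (Λ.repV.comp (res ι)) s v :=
  (h v).comp (continuous_res ι)

lemma GaloisLattice.continuous_repA_apply (Λ : GaloisLattice p) (ι : Qbar →ₐ[ℚ] PadicAlgCl ℓ)
    (h : ∀ v, Continuous fun g => Λ.rep g v) (a : Λ.A) :
    Continuous fun s => (Λ.repA.comp (res ι)) s a := by
  obtain ⟨v, rfl⟩ := Λ.lattice.mkQ_surjective a
  exact Λ.continuous_mkQ.comp (Λ.continuous_repV_apply ι h v)

/-- The Teichmüller lift is multiplicative, so the relation `β² = 1` lifts, and `ℤ_p` is a domain.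
Hence `ψ` is a sign at such elements. -/
lemma teichLift_sq_eq_one {β : GQ →* (ZMod p)ˣ} {g : GQ} (h : (β g : ZMod p) ^ 2 = 1) :
    (((teichLift β)⁻¹ g : ℤ_[p]ˣ) : ℤ_[p]) = 1 ∨ (((teichLift β)⁻¹ g : ℤ_[p]ˣ) : ℤ_[p]) = -1 := by
  have h1 : β g ^ 2 = 1 := Units.ext (by simpa using h)
  have h2 : (teichLift β g) ^ 2 = 1 := by
    rw [teichLift, MonoidHom.comp_apply, ← map_pow, h1, map_one]
  have h3 : ((teichLift β)⁻¹ g) ^ 2 = 1 := by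
    rw [MonoidHom.inv_apply, inv_pow, h2, inv_one]
  have h4 := congrArg Units.val h3
  rw [Units.val_pow_eq_pow_val, Units.val_one] at h4
  exact sq_eq_one_iff.1 h4

end TwistedLattices

/-! ### The character `β` and the shape of `ℓ` at a trivial prime -/

section LocalCharacter

variable {p : ℕ} [Fact p.Prime] {ℓ : ℕ} [Fact ℓ.Prime]
  {rbar : GQ →* GL (Fin 2) (ZMod p)} {β : GQ →* (ZMod p)ˣ} {ι : Qbar →ₐ[ℚ] PadicAlgCl ℓ}

lemma IsTrivialPrime.ne (hℓ : IsTrivialPrime rbar ι) : ℓ ≠ p := by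
  rintro rfl
  have h := hℓ.modEq
  rw [Nat.ModEq, Nat.mod_self, Nat.mod_eq_of_lt (Fact.out : ℓ.Prime).one_lt] at h
  exact zero_ne_one h

/-- The upper left entry of the trivial matrix. Where `χ̄` is also trivial it gives `β² = 1`, so
only a quadratic ambiguity of the twist survives. -/
lemma IsTrivialPrime.toZMod_chi (hℓ : IsTrivialPrime rbar ι) (hrbar : IsResidual rbar β)
    (s : GLoc ℓ) :
    PadicInt.toZMod (chi p (res ι s) : ℤ_[p]) * (β (res ι s) : ZMod p) ^ 2 = 1 := by
  rw [← hrbar.apply_zero_zero, hℓ.trivial]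
  rfl

lemma IsTrivialPrime.beta_sq_of_inertia (hℓ : IsTrivialPrime rbar ι) (hrbar : IsResidual rbar β)
    {s : GLoc ℓ} (hs : s ∈ inertia ℓ) : (β (res ι s) : ZMod p) ^ 2 = 1 := by
  have h := hℓ.toZMod_chi hrbar s
  rwa [chi_res_inertia hℓ.ne ι hs, Units.val_one, map_one, one_mul] at h

lemma chi_res_frobenius (hℓ : ℓ ≠ p) {σ : GLoc ℓ} (hσ : IsFrobenius σ) :
    (chi p (res ι σ) : ℤ_[p]) = ℓ := chi_res_eq hℓ ι hσ

lemma IsTrivialPrime.beta_sq_of_frobenius (hℓ : IsTrivialPrime rbar ι)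
    (hrbar : IsResidual rbar β) {σ : GLoc ℓ} (hσ : IsFrobenius σ) :
    (β (res ι σ) : ZMod p) ^ 2 = 1 := by
  have h := hℓ.toZMod_chi hrbar σ
  have h1 : (ℓ : ZMod p) = 1 := by
    have := (ZMod.natCast_eq_natCast_iff ℓ 1 p).2 hℓ.modEq
    rwa [Nat.cast_one] at this
  rwa [chi_res_frobenius hℓ.ne hσ, map_natCast, h1, one_mul] at h

/-- `ℓ = 1 + p u` with `u` prime to `p`. -/
lemma IsTrivialPrime.exists_eq (hℓ : IsTrivialPrime rbar ι) : ∃ u : ℕ, ℓ = 1 + p * u ∧ ¬ p ∣ u := by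
  have h1 : 1 ≤ ℓ := (Fact.out : ℓ.Prime).one_lt.le
  obtain ⟨u, hu⟩ := (Nat.modEq_iff_dvd' h1).1 hℓ.modEq.symm
  refine ⟨u, by omega, fun ⟨w, hw⟩ => hℓ.not_modEq ?_⟩
  refine ((Nat.modEq_iff_dvd' h1).2 ⟨w, ?_⟩).symm
  rw [hu, hw, pow_two, mul_assoc]

end LocalCharacter

/-! ### Type II coordinates -/

section TypeIICoordinates

variable {p : ℕ} [Fact p.Prime] {ℓ : ℕ}
  {C A : GL (Fin 2) ℤ_[p]} {x y : ℤ_[p]}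

lemma act_frob_zero
    (h : ((C * A * C⁻¹ : GL (Fin 2) ℤ_[p]) : Matrix (Fin 2) (Fin 2) ℤ_[p]) =
      !![1, 0; x, (ℓ : ℤ_[p])]) (v : Vsp p) : act C.1 (act A.1 v) 0 = act C.1 v 0 := by
  rw [act_conj h, act_apply_zero]
  simp

lemma act_frob_one
    (h : ((C * A * C⁻¹ : GL (Fin 2) ℤ_[p]) : Matrix (Fin 2) (Fin 2) ℤ_[p]) =
      !![1, 0; x, (ℓ : ℤ_[p])]) (v : Vsp p) :
    act C.1 (act A.1 v) 1 = x * act C.1 v 0 + ℓ * act C.1 v 1 := by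
  rw [act_conj h, act_apply_one]
  simp

lemma act_tame_zero
    (h : ((C * A * C⁻¹ : GL (Fin 2) ℤ_[p]) : Matrix (Fin 2) (Fin 2) ℤ_[p]) = !![1, 0; y, 1])
    (v : Vsp p) : act C.1 (act A.1 v) 0 = act C.1 v 0 := by
  rw [act_conj h, act_apply_zero]
  simp

lemma act_tame_one
    (h : ((C * A * C⁻¹ : GL (Fin 2) ℤ_[p]) : Matrix (Fin 2) (Fin 2) ℤ_[p]) = !![1, 0; y, 1])
    (v : Vsp p) : act C.1 (act A.1 v) 1 = y * act C.1 v 0 + act C.1 v 1 := by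
  rw [act_conj h, act_apply_one]
  simp

lemma act_injective (C : GL (Fin 2) ℤ_[p]) : Function.Injective (act C.1) :=
  Function.LeftInverse.injective (act_inv_act C)

/-- The vector with `C`-coordinates `(a, c)`. -/
def coordVec (C : GL (Fin 2) ℤ_[p]) (a c : ℚ_[p]) : Vsp p :=
  act (C⁻¹ : GL (Fin 2) ℤ_[p]).1 ![a, c]

lemma act_coordVec_zero (C : GL (Fin 2) ℤ_[p]) (a c : ℚ_[p]) :
    act C.1 (coordVec C a c) 0 = a := by
  rw [coordVec, act_act_inv]
  rfl

lemma act_coordVec_one (C : GL (Fin 2) ℤ_[p]) (a c : ℚ_[p]) :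
    act C.1 (coordVec C a c) 1 = c := by
  rw [coordVec, act_act_inv]
  rfl

lemma act_tame_coordVec
    (h : ((C * A * C⁻¹ : GL (Fin 2) ℤ_[p]) : Matrix (Fin 2) (Fin 2) ℤ_[p]) = !![1, 0; y, 1])
    (c : ℚ_[p]) : act A.1 (coordVec C 0 c) = coordVec C 0 c := by
  refine act_injective C (vsp_ext ?_ ?_)
  · rw [act_tame_zero h]
  · rw [act_tame_one h, act_coordVec_zero, mul_zero, zero_add]

lemma norm_eq_inv_of_dvd (h1 : (p : ℤ_[p]) ∣ y) (h2 : ¬ (p : ℤ_[p]) ^ 2 ∣ y) :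
    ‖(y : ℚ_[p])‖ = (p : ℝ)⁻¹ := by
  obtain ⟨z, rfl⟩ := h1
  have h3 : ¬ (p : ℤ_[p]) ∣ z := fun ⟨w, hw⟩ => h2 ⟨w, by rw [hw]; ring⟩
  have h4 : ‖z‖ = 1 := by
    refine le_antisymm (PadicInt.norm_le_one z) (not_lt.1 fun h5 => h3 ?_)
    exact (PadicInt.norm_lt_one_iff_dvd z).1 h5
  rw [PadicInt.coe_mul, norm_mul, PadicInt.coe_natCast, Padic.norm_p, ← PadicInt.norm_def, h4,
    mul_one]

/-- A vector fixed by the tame generator modulo a lattice has first coordinate in `p⁻¹ ℤ_p`. -/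
lemma norm_le_of_tame_fixed {r : ℝ} (hr : 1 ≤ r) (hp : r ≤ p) (hC : redGL p C = 1)
    (h1 : (p : ℤ_[p]) ∣ y) (h2 : ¬ (p : ℤ_[p]) ^ 2 ∣ y)
    (h : ((C * A * C⁻¹ : GL (Fin 2) ℤ_[p]) : Matrix (Fin 2) (Fin 2) ℤ_[p]) = !![1, 0; y, 1])
    {v : Vsp p} (hv : InLat r (act A.1 v - v)) : ‖act C.1 v 0‖ ≤ p := by
  have h3 := ((inLat_act_iff hr hp hC).2 hv).2
  have hp0 : (0 : ℝ) < p := by exact_mod_cast (Fact.out : p.Prime).pos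
  rw [map_sub, Pi.sub_apply, act_tame_one h, add_sub_cancel_right, norm_mul,
    norm_eq_inv_of_dvd h1 h2, inv_mul_le_iff₀ hp0, mul_one] at h3
  exact h3

end TypeIICoordinates

/-! ### Invariants, unramified classes and the values of `δ_ℓ` -/

section LocalComputation

variable {p : ℕ} [Fact p.Prime] {ℓ : ℕ} [Fact ℓ.Prime]
  {rbar : GQ →* GL (Fin 2) (ZMod p)} {β : GQ →* (ZMod p)ˣ} {ρ : GQ →* GL (Fin 2) ℤ_[p]}
  {ι : Qbar →ₐ[ℚ] PadicAlgCl ℓ}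

lemma IsTrivialPrime.redGL_eq_one (hℓ : IsTrivialPrime rbar ι) (hρ : IsLift ρ rbar) (s : GLoc ℓ) :
    redGL p ((ρ.comp (res ι)) s) = 1 := by
  rw [MonoidHom.comp_apply, hρ.red, hℓ.trivial]

lemma IsLift.continuous_comp_res (hρ : IsLift ρ rbar) : Continuous (ρ.comp (res ι)) :=
  hρ.continuous_rho.comp (continuous_res ι)

lemma continuous_twist_teichLift (hρ : IsLift ρ rbar) (hrbar : IsResidual rbar β) (v : Vsp p) :
    Continuous fun g => act (twist ρ (teichLift β)⁻¹ g) v :=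
  continuous_act (continuous_twist hρ.continuous_rho
    (continuous_teichLift hrbar.continuous_beta).inv) v

lemma one_le_cast_prime : (1 : ℝ) ≤ p := by exact_mod_cast (Fact.out : p.Prime).one_lt.le

/-- A vector on which an element of a residually trivial representation acts as `-1` modulo a
lattice lies in the lattice. -/
lemma inLat_of_act_eq_neg (hp : p ≠ 2) {A : GL (Fin 2) ℤ_[p]} (hA : redGL p A = 1) {r : ℝ}
    (hr : 1 ≤ r) (hrp : r ≤ p) {v : Vsp p} (hv : InLat r (-act A.1 v - v)) : InLat r v := by
  -- Iterating `-A v ≡ v` gives `(-1)ⁿ Aⁿ v ≡ v`. For the odd exponent `n = p ^ k`, with `k` large,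
  -- also `Aⁿ v ≡ v`. Hence `2 v` is in the lattice, and `2` is a unit.
  have hpow : ∀ n : ℕ, InLat r (((-1 : ℚ_[p]) ^ n) • act (A ^ n).1 v - v) := by
    intro n
    induction n with
    | zero => simpa [act_one] using InLat.zero (zero_le_one.trans hr)
    | succ n ih =>
      have e : ((-1 : ℚ_[p]) ^ (n + 1)) • act (A ^ (n + 1)).1 v - v =
          -act A.1 (((-1 : ℚ_[p]) ^ n) • act (A ^ n).1 v - v) + (-act A.1 v - v) := by
        rw [pow_succ' A, Units.val_mul, act_mul, map_sub, map_smul, pow_succ (-1 : ℚ_[p]), mul_smul,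
          neg_one_smul, smul_neg]
        abel
      rw [e]
      exact ((ih.act hr hrp (dvd_of_redGL_eq_one hA)).neg).add hv
  obtain ⟨k, hk⟩ := exists_inLat_pow_smul v
  obtain ⟨Y, hY⟩ := exists_pow_eq_one_add hA k
  have h1 := (inLat_act_pow_sub hk hY).mono hr
  have hodd : Odd (p ^ k) := ((Fact.out : p.Prime).odd_of_ne_two hp).pow
  have h2 := hpow (p ^ k)
  rw [hodd.neg_one_pow, neg_one_smul] at h2
  have h3 : InLat r (-((2 : ℚ_[p]) • v)) := by
    have e : -((2 : ℚ_[p]) • v) = (act (A ^ p ^ k).1 v - v) + (-act (A ^ p ^ k).1 v - v) := by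
      rw [two_smul]
      abel
    rw [e]
    exact h1.add h2
  have hn : ‖(2 : ℚ_[p])‖ = 1 := by
    have h4 : ‖((2 : ℕ) : ℚ_[p])‖ = 1 := by
      rw [Padic.norm_natCast_eq_one_iff, Nat.coprime_primes Fact.out Nat.prime_two]
      exact hp
    exact_mod_cast h4
  have h5 := h3.neg.smul (c := (2 : ℚ_[p])⁻¹) (by rw [norm_inv, hn, inv_one])
  rwa [neg_neg, smul_smul, inv_mul_cancel₀ two_ne_zero, one_smul] at h5

/-- Unramified classes with values in `A'` are trivial. -/
lemma H1nr_latticeT'_eq_bot (hp : 5 ≤ p) (hrbar : IsResidual rbar β) (hρ : IsLift ρ rbar)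
    (hℓ : IsTrivialPrime rbar ι) {σ : GLoc ℓ} (hσ : IsFrobenius σ) {τ : inertia ℓ}
    (hτ : IsTameGenerator p τ) (hII : IsTypeII σ τ (ρ.comp (res ι))) :
    H1nr ((latticeT' ρ (teichLift β)⁻¹ (hρ.dvd hrbar.apply_one_zero)).repA.comp (res ι)) ⊥ = ⊥ := by
  obtain ⟨C, hC, x, y, -, hy, hy', hCσ, hCτ⟩ := hII
  set ψ := (teichLift β)⁻¹ with hψ
  set Λ := latticeT' ρ ψ (hρ.dvd hrbar.apply_one_zero) with hΛ
  have hmem : ∀ v, v ∈ Λ.lattice ↔ InLat p v := fun v => mem_latticeT'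
  have hrep : ∀ s v, Λ.rep (res ι s) v =
      ((ψ (res ι s) : ℤ_[p]) : ℚ_[p]) • act ((ρ.comp (res ι)) s).1 v := fun s v =>
    act_twist ρ ψ (res ι s) v
  have h1 := hℓ.redGL_eq_one hρ
  have hp1 : (1 : ℝ) ≤ p := one_le_cast_prime
  refine H1nr_eq_bot (Λ.continuous_repA_apply ι (continuous_twist_teichLift hρ hrbar)) hσ
    (Λ.isClosed_zero ?_) fun b hb => ?_
  · convert isClosed_setOf_inLat (p := p) p using 1
    ext v
    exact hmem v
  obtain ⟨v, rfl⟩ := Λ.lattice.mkQ_surjective b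
  have hfix : ∀ s ∈ inertia ℓ,
      InLat p (((ψ (res ι s) : ℤ_[p]) : ℚ_[p]) • act ((ρ.comp (res ι)) s).1 v - v) := by
    intro s hs
    have h2 := hb s hs
    rw [Λ.repA_mkQ, Λ.mkQ_eq_iff, hmem, hrep] at h2
    exact h2
  -- If `ψ` is trivial on inertia, the invariants are those of `ρ`. Otherwise some inertia element
  -- acts as `-ρ(s)` and `A'` has no nonzero invariants.
  by_cases hI : ∀ s ∈ inertia ℓ, (ψ (res ι s) : ℤ_[p]) = 1
  · have hw := norm_le_of_tame_fixed hp1 le_rfl hC hy hy' hCτ (v := v) (by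
      have h2 := hfix τ τ.2
      rwa [hI τ τ.2, PadicInt.coe_one, one_smul] at h2)
    set e : ℚ_[p] := ((ψ (res ι σ) : ℤ_[p]) : ℚ_[p]) with he
    have he0 : e * ℓ - 1 ≠ 0 := by
      rcases teichLift_sq_eq_one (hℓ.beta_sq_of_frobenius hrbar hσ) with h2 | h2
      · rw [he, h2, PadicInt.coe_one, one_mul, sub_ne_zero]
        exact_mod_cast (Fact.out : ℓ.Prime).one_lt.ne'
      · rw [he, h2, PadicInt.coe_neg, PadicInt.coe_one, neg_one_mul, ← neg_add', neg_ne_zero]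
        exact_mod_cast Nat.succ_ne_zero ℓ
    -- On the line `v₀ = 0`, fixed by `τ`, the twisted Frobenius acts by `e ℓ` with `e = ±1`, so
    -- dividing by `e ℓ - 1` matches the second coordinate exactly. The first has norm at most `p`,
    -- hence is zero modulo `T'`.
    refine ⟨Λ.lattice.mkQ (coordVec C 0 (act C.1 v 1 / (e * ℓ - 1))), fun s hs => ?_, ?_⟩
    · rw [Λ.repA_mkQ, Λ.mkQ_eq_iff, hmem, hrep, hI s hs, PadicInt.coe_one, one_smul]
      refine inLat_act_sub_of_tame hρ.continuous_comp_res h1 hτ hp1 le_rfl ?_ hs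
      rw [act_tame_coordVec hCτ, sub_self]
      exact InLat.zero (zero_le_one.trans hp1)
    · rw [Λ.repA_mkQ, ← map_sub, Λ.mkQ_eq_iff, hmem, hrep, ← he, ← inLat_act_iff hp1 le_rfl hC]
      simp only [map_sub, map_smul]
      constructor
      · simp only [Pi.sub_apply, Pi.smul_apply, act_frob_zero hCσ, act_coordVec_zero, smul_zero,
          sub_self, zero_sub, norm_neg]
        exact hw
      · simp only [Pi.sub_apply, Pi.smul_apply, act_frob_one hCσ, act_coordVec_zero,
          act_coordVec_one, smul_eq_mul, mul_zero, zero_add]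
        have e1 : e * (ℓ * (act C.1 v 1 / (e * ℓ - 1))) - act C.1 v 1 / (e * ℓ - 1) -
            act C.1 v 1 = 0 := by
          field_simp
          ring
        rw [e1, norm_zero]
        exact zero_le_one
  · push Not at hI
    obtain ⟨s, hs, hne⟩ := hI
    have h2 := (teichLift_sq_eq_one (hℓ.beta_sq_of_inertia hrbar hs)).resolve_left hne
    have h3 := hfix s hs
    rw [h2, PadicInt.coe_neg, PadicInt.coe_one, neg_one_smul] at h3
    have h4 := inLat_of_act_eq_neg (by omega) (h1 s) hp1 le_rfl h3
    refine ⟨0, fun s _ => map_zero _, ?_⟩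
    rw [map_zero, sub_zero, ← map_zero Λ.lattice.mkQ, Λ.mkQ_eq_iff, hmem, zero_sub]
    exact h4.neg

lemma teichLift_inv_eq_one {g : GQ} (h : β g = 1) :
    (((teichLift β)⁻¹ g : ℤ_[p]ˣ) : ℤ_[p]) = 1 := by
  rw [MonoidHom.inv_apply, teichLift, MonoidHom.comp_apply, h, map_one, inv_one, Units.val_one]

lemma latticeT_rep_apply (hβ : ∀ s : GLoc ℓ, β (res ι s) = 1) (s : GLoc ℓ) (v : Vsp p) :
    (latticeT ρ (teichLift β)⁻¹).rep (res ι s) v = act ((ρ.comp (res ι)) s).1 v := by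
  refine (act_twist ρ (teichLift β)⁻¹ (res ι s) v).trans ?_
  rw [teichLift_inv_eq_one (hβ s), PadicInt.coe_one, one_smul]
  rfl

lemma natCast_sub_one_ne_zero : (ℓ : ℚ_[p]) - 1 ≠ 0 := by
  rw [sub_ne_zero]
  exact_mod_cast (Fact.out : ℓ.Prime).one_lt.ne'

/-- `H¹_f` vanishes. -/
lemma H1f_latticeT_eq_bot (hrbar : IsResidual rbar β) (hρ : IsLift ρ rbar)
    (hβ : ∀ s : GLoc ℓ, β (res ι s) = 1) {σ : GLoc ℓ} (hσ : IsFrobenius σ) {τ : inertia ℓ}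
    (hII : IsTypeII σ τ (ρ.comp (res ι))) : (latticeT ρ (teichLift β)⁻¹).H1f ι = ⊥ := by
  obtain ⟨C, hC, x, y, -, hy, hy', hCσ, hCτ⟩ := hII
  set Λ := latticeT ρ (teichLift β)⁻¹ with hΛ
  have hrep : ∀ s v, (Λ.repV.comp (res ι)) s v = act ((ρ.comp (res ι)) s).1 v :=
    latticeT_rep_apply hβ
  have h1 : H1nr (Λ.repV.comp (res ι)) ⊥ = ⊥ := by
    refine H1nr_eq_bot (Λ.continuous_repV_apply ι (continuous_twist_teichLift hρ hrbar)) hσ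
      isClosed_singleton fun v hv => ?_
    have hℓ0 : (ℓ : ℚ_[p]) - 1 ≠ 0 := natCast_sub_one_ne_zero
    -- In `V` there is no lattice to absorb `y v₀`: as `y ≠ 0`, invariance under `τ` forces `v₀ =
    -- 0`, leaving the line where `σ` acts by `ℓ`.
    have hw : act C.1 v 0 = 0 := by
      have h2 := hv τ τ.2
      rw [hrep] at h2
      have h3 := act_tame_one hCτ v
      rw [h2, right_eq_add, mul_eq_zero] at h3
      refine h3.resolve_left fun h4 => hy' ?_
      rw [PadicInt.coe_eq_zero] at h4
      rw [h4]
      exact dvd_zero _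
    refine ⟨((ℓ : ℚ_[p]) - 1)⁻¹ • v, fun s hs => ?_, ?_⟩
    · have h2 := hv s hs
      rw [hrep] at h2 ⊢
      rw [map_smul, h2]
    · rw [hrep]
      refine act_injective C (vsp_ext ?_ ?_)
      · rw [map_sub, Pi.sub_apply, act_frob_zero hCσ, sub_self, hw]
      · rw [map_sub, Pi.sub_apply, act_frob_one hCσ, map_smul, Pi.smul_apply, Pi.smul_apply, hw,
          smul_zero, mul_zero, zero_add, smul_eq_mul, ← sub_one_mul, ← mul_assoc,
          mul_inv_cancel₀ hℓ0, one_mul]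
  rw [GaloisLattice.H1f, h1, AddSubgroup.map_bot]

/-- The scalars `(χ(s) - 1) / p²`. -/
def chiScalar (p : ℕ) [Fact p.Prime] (ι : Qbar →ₐ[ℚ] PadicAlgCl ℓ) (s : GLoc ℓ) : ℚ_[p] :=
  (((chi p (res ι s) : ℤ_[p]) : ℚ_[p]) - 1) / (p : ℚ_[p]) ^ 2

lemma continuous_chiScalar : Continuous (chiScalar p ι) := by
  have h : Continuous fun s => (chi p (res ι s) : ℤ_[p]) :=
    Units.continuous_val.comp (continuous_chi.comp (continuous_res ι))
  exact ((continuous_subtype_val.comp h).sub continuous_const).div_const _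

/-- With `β` trivial on the decomposition group, `χ̄ β² = 1` gives `χ ≡ 1 mod p` there. The scalars
thus lie in `p⁻¹ℤ_p`, which makes the cocycle below killed by `p`. -/
lemma exists_chiScalar_eq (hrbar : IsResidual rbar β) (hℓ : IsTrivialPrime rbar ι)
    (hβ : ∀ s : GLoc ℓ, β (res ι s) = 1) (s : GLoc ℓ) :
    ∃ a : ℤ_[p], chiScalar p ι s = a / p ∧ (chi p (res ι s) : ℤ_[p]) = 1 + p * a := by
  have hp : (p : ℚ_[p]) ≠ 0 := Nat.cast_ne_zero.2 (Fact.out : p.Prime).ne_zero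
  have h1 := hℓ.toZMod_chi hrbar s
  rw [hβ, Units.val_one, one_pow, mul_one, ← sub_eq_zero, ← map_one PadicInt.toZMod, ← map_sub,
    toZMod_eq_zero_iff] at h1
  obtain ⟨a, ha⟩ := h1
  rw [sub_eq_iff_eq_add'] at ha
  refine ⟨a, ?_, ha⟩
  rw [chiScalar, ha]
  push_cast
  field_simp
  ring

lemma chiScalar_inertia (hℓ : ℓ ≠ p) {s : GLoc ℓ} (hs : s ∈ inertia ℓ) : chiScalar p ι s = 0 := by
  rw [chiScalar, chi_res_inertia hℓ ι hs]
  simp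

/-- The unramified cocycle `s ↦ (χ(s) - 1) p⁻² f` with values in `A`. -/
lemma exists_chiCocycle (hrbar : IsResidual rbar β) (hρ : IsLift ρ rbar)
    (hℓ : IsTrivialPrime rbar ι) (hβ : ∀ s : GLoc ℓ, β (res ι s) = 1) {f : Vsp p}
    (hf : InLat 1 f) :
    ∃ z : Z1 (((latticeT ρ (teichLift β)⁻¹).repA.comp (res ι)).comp
      (⊥ : IntermediateField ℚ_[ℓ] (PadicAlgCl ℓ)).fixingSubgroup.subtype),
      ∀ s, evalAt z s = (latticeT ρ (teichLift β)⁻¹).lattice.mkQ (chiScalar p ι s • f) := by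
  have hp : (p : ℚ_[p]) ≠ 0 := Nat.cast_ne_zero.2 (Fact.out : p.Prime).ne_zero
  set Λ := latticeT ρ (teichLift β)⁻¹ with hΛ
  have hcont : Continuous fun s => chiScalar p ι s • f := by
    have h := continuous_chiScalar (p := p) (ι := ι)
    fun_prop
  refine ⟨Z1.ofFun (fun s => Λ.lattice.mkQ (chiScalar p ι s • f))
    (Λ.continuous_mkQ.comp hcont) fun s t => ?_,
    fun s => rfl⟩
  rw [Λ.repA_mkQ, ← map_add, Λ.mkQ_eq_iff, mem_latticeT, latticeT_rep_apply hβ]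
  obtain ⟨a, ha, ha'⟩ := exists_chiScalar_eq hrbar hℓ hβ s
  obtain ⟨b, hb, hb'⟩ := exists_chiScalar_eq hrbar hℓ hβ t
  obtain ⟨Y, hY⟩ := exists_of_redGL_eq_one (hℓ.redGL_eq_one hρ s)
  -- Multiplicativity of `χ` makes the scalar additive up to the integer `a b`. The action of `ρ(s)
  -- = 1 + p Y` on `(b / p) f` adds only `b Y f`. Both errors lie in `T`.
  have hst : chiScalar p ι (s * t) = a / p + b / p + a * b := by
    rw [chiScalar, map_mul, map_mul, Units.val_mul, ha', hb']
    push_cast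
    field_simp
    ring
  have e : chiScalar p ι (s * t) • f - (chiScalar p ι s • f +
      act ((ρ.comp (res ι)) s).1 (chiScalar p ι t • f)) =
      ((a * b : ℤ_[p]) : ℚ_[p]) • f - (b : ℚ_[p]) • act Y f := by
    rw [hst, hY, act_one_add_smul, map_smul, ha, hb, smul_smul, PadicInt.coe_natCast,
      mul_div_cancel₀ _ hp]
    push_cast
    module
  rw [e]
  exact (hf.smul (norm_coe_le_one _)).sub ((hf.act_one Y).smul (norm_coe_le_one _))

/-- `δ_ℓ(A) = 1`. -/
lemma delta_latticeT_eq_one (hrbar : IsResidual rbar β) (hρ : IsLift ρ rbar)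
    (hℓ : IsTrivialPrime rbar ι) (hβ : ∀ s : GLoc ℓ, β (res ι s) = 1) {σ : GLoc ℓ}
    (hσ : IsFrobenius σ) {τ : inertia ℓ} (hτ : IsTameGenerator p τ)
    (hII : IsTypeII σ τ (ρ.comp (res ι))) : (latticeT ρ (teichLift β)⁻¹).delta ι = 1 := by
  have hf := H1f_latticeT_eq_bot hrbar hρ hβ hσ hII
  obtain ⟨C, hC, x, y, -, hy, hy', hCσ, hCτ⟩ := hII
  have hp : (p : ℚ_[p]) ≠ 0 := Nat.cast_ne_zero.2 (Fact.out : p.Prime).ne_zero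
  have hp1 : (1 : ℝ) ≤ p := one_le_cast_prime
  have hp0 : (0 : ℝ) < p := zero_lt_one.trans_le hp1
  have h1 := hℓ.redGL_eq_one hρ
  have hf1 : InLat 1 (coordVec C 1 0) :=
    InLat.act_one (by simp [InLat]) _
  obtain ⟨u, hu, hpu⟩ := hℓ.exists_eq
  set Λ := latticeT ρ (teichLift β)⁻¹ with hΛ
  obtain ⟨z, hz⟩ : ∃ z : Z1 ((Λ.repA.comp (res ι)).comp
      (⊥ : IntermediateField ℚ_[ℓ] (PadicAlgCl ℓ)).fixingSubgroup.subtype),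
      ∀ s, evalAt z s = Λ.lattice.mkQ (chiScalar p ι s • coordVec C 1 0) :=
    exists_chiCocycle hrbar hρ hℓ hβ hf1
  have hrep : ∀ s v, Λ.rep (res ι s) v = act ((ρ.comp (res ι)) s).1 v := latticeT_rep_apply hβ
  have hmem : ∀ v, v ∈ Λ.lattice ↔ InLat 1 v := fun v => mem_latticeT
  have hθ := Λ.continuous_repA_apply ι (continuous_twist_teichLift hρ hrbar)
  have hcl : IsClosed ({0} : Set Λ.A) := by
    refine Λ.isClosed_zero ?_
    convert isClosed_setOf_inLat (p := p) 1 using 1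
    ext v
    exact hmem v
  have hzI : ∀ s ∈ inertia ℓ, evalAt z s = 0 := fun s hs => by
    rw [hz, chiScalar_inertia hℓ.ne hs, zero_smul, map_zero]
  have hσu : chiScalar p ι σ = u / p := by
    rw [chiScalar, chi_res_frobenius hℓ.ne hσ, PadicInt.coe_natCast, hu]
    push_cast
    field_simp
    ring
  have hun : ‖(u : ℚ_[p])‖ = 1 := by
    rw [Padic.norm_natCast_eq_one_iff]
    exact ((Fact.out : p.Prime).coprime_iff_not_dvd).2 hpu
  refine Λ.delta_eq_one hℓ.ne ι hf (H1.mk _ z) ?_ ?_ ?_ ?_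
  · refine mem_H1nr_mk.2 ⟨0, fun s _ hi => ?_⟩
    rw [map_zero, sub_zero]
    exact hzI s hi
  -- The first coordinate of `(σ - 1) v` is zero, whereas the cocycle has first coordinate `u / p`
  -- at `σ`, of norm `p > 1`.
  · intro h0
    obtain ⟨a, ha⟩ := H1.mk_eq_zero.1 h0
    obtain ⟨v, rfl⟩ := Λ.lattice.mkQ_surjective a
    have h2 : evalAt z σ = Λ.lattice.mkQ (Λ.rep (res ι σ) v) - Λ.lattice.mkQ v :=
      ha ⟨σ, mem_fixing_bot σ⟩
    rw [hz, ← map_sub, Λ.mkQ_eq_iff, hmem, hrep, ← inLat_act_iff le_rfl hp1 hC] at h2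
    have h3 := h2.1
    simp only [map_sub, map_smul, Pi.sub_apply, Pi.smul_apply, act_frob_zero hCσ, sub_self,
      sub_zero, act_coordVec_zero, smul_eq_mul, mul_one] at h3
    rw [hσu, norm_div, hun, Padic.norm_p, one_div, inv_inv] at h3
    exact absurd h3 (not_le.2 (by exact_mod_cast (Fact.out : p.Prime).one_lt))
  · have h2 : p • z = 0 := by
      refine Subtype.ext (funext fun s => ?_)
      obtain ⟨a, ha, -⟩ := exists_chiScalar_eq hrbar hℓ hβ s.1
      have h3 : p • evalAt z s.1 = 0 := by
        rw [hz, ← map_nsmul, ← map_zero Λ.lattice.mkQ, Λ.mkQ_eq_iff, hmem, sub_zero, ha,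
          ← Nat.cast_smul_eq_nsmul ℚ_[p], smul_smul, mul_div_cancel₀ _ hp]
        exact hf1.smul (norm_coe_le_one a)
      exact h3
    rw [← map_nsmul, h2, map_zero]
  · intro c hc
    obtain ⟨z', rfl, hz'⟩ := exists_of_mem_H1nr hθ hc
    obtain ⟨v, hv⟩ := Λ.lattice.mkQ_surjective (evalAt z' σ)
    have hfix : InLat 1 (act ((ρ.comp (res ι)) τ).1 v - v) := by
      have h2 := evalAt_fixed z' hz' σ τ.2
      rw [← hv, Λ.repA_mkQ, Λ.mkQ_eq_iff, hmem, hrep] at h2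
      exact h2
    have hw := norm_le_of_tame_fixed le_rfl hp1 hC hy hy' hCτ hfix
    have hw' : ‖(p : ℚ_[p]) * act C.1 v 0‖ ≤ 1 := by
      rw [norm_mul, Padic.norm_p, inv_mul_le_iff₀ hp0, mul_one]
      exact hw
    obtain ⟨w, hw⟩ : ∃ w : ℤ_[p], (w : ℚ_[p]) = p * act C.1 v 0 := ⟨⟨_, hw'⟩, rfl⟩
    -- With `w = p v₀`, this `m` solves `m u ≡ w mod p`. Subtracting `m` times the cocycle leaves an
    -- integral first coordinate at `σ`.
    let m : ℕ := (PadicInt.toZMod w * (u : ZMod p)⁻¹).val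
    obtain ⟨d, hd⟩ : (p : ℤ_[p]) ∣ w - m * u := by
      have hu0 : (u : ZMod p) ≠ 0 := by rwa [Ne, ZMod.natCast_eq_zero_iff]
      rw [← toZMod_eq_zero_iff, map_sub, map_mul, map_natCast, map_natCast, ZMod.natCast_zmod_val,
        mul_assoc, inv_mul_cancel₀ hu0, mul_one, sub_self]
    have hd' : act C.1 v 0 = m * (u / p) + d := by
      have h2 := congrArg (fun t : ℤ_[p] => (t : ℚ_[p])) hd
      push_cast at h2
      rw [hw, sub_eq_iff_eq_add] at h2
      field_simp
      linear_combination h2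
    have hℓ0 : (ℓ : ℚ_[p]) - 1 ≠ 0 := natCast_sub_one_ne_zero
    refine ⟨m, ?_⟩
    rw [← sub_eq_zero, ← map_nsmul, ← map_sub]
    -- The remaining second coordinate is a Frobenius coboundary: `σ - 1` acts by `ℓ - 1` on the
    -- line `v₀ = 0`, whose classes are fixed by inertia.
    refine H1.mk_eq_zero_of_frobenius hθ hσ hcl _ (fun s hs => ?_)
      (a := Λ.lattice.mkQ (coordVec C 0 (act C.1 v 1 / (ℓ - 1)))) (fun s hs => ?_) ?_
    · change evalAt z' s - m • evalAt z s = 0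
      rw [hz' s hs, hzI s hs, nsmul_zero, sub_zero]
    · rw [Λ.repA_mkQ, Λ.mkQ_eq_iff, hmem, hrep]
      refine inLat_act_sub_of_tame hρ.continuous_comp_res h1 hτ le_rfl hp1 ?_ hs
      rw [act_tame_coordVec hCτ, sub_self]
      exact InLat.zero zero_le_one
    · change evalAt z' σ - m • evalAt z σ = _
      rw [← hv, hz, Λ.repA_mkQ, ← map_nsmul, ← map_sub, ← map_sub, Λ.mkQ_eq_iff, hmem, hrep,
        ← inLat_act_iff le_rfl hp1 hC, ← Nat.cast_smul_eq_nsmul ℚ_[p]]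
      simp only [map_sub, map_smul]
      constructor
      · simp only [Pi.sub_apply, Pi.smul_apply, act_frob_zero hCσ, act_coordVec_zero, sub_self,
          sub_zero, smul_eq_mul, mul_one, hσu, hd', add_sub_cancel_left]
        exact norm_coe_le_one d
      · simp only [Pi.sub_apply, Pi.smul_apply, act_frob_one hCσ, act_coordVec_zero,
          act_coordVec_one, smul_eq_mul, mul_zero, zero_add, sub_zero]
        have e1 : act C.1 v 1 - (ℓ * (act C.1 v 1 / (ℓ - 1)) - act C.1 v 1 / (ℓ - 1)) = 0 := by
          field_simp
          ring
        rw [e1, norm_zero]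
        exact zero_le_one

end LocalComputation

end TypeTwo
end

theorem mainTheorem12 (p : ℕ) [Fact p.Prime] (hp : 5 ≤ p)
    (rbar : TypeTwo.GQ →* GL (Fin 2) (ZMod p)) (β : TypeTwo.GQ →* (ZMod p)ˣ)
    (hrbar : TypeTwo.IsResidual rbar β)
    (ρ : TypeTwo.GQ →* GL (Fin 2) ℤ_[p]) (hρ : TypeTwo.IsLift ρ rbar)
    (ℓ : ℕ) [Fact ℓ.Prime] (ι : TypeTwo.Qbar →ₐ[ℚ] PadicAlgCl ℓ)
    (hℓ : TypeTwo.IsTrivialPrime rbar ι)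
    (σ : TypeTwo.GLoc ℓ) (hσ : TypeTwo.IsFrobenius σ)
    (τ : TypeTwo.inertia ℓ) (hτ : TypeTwo.IsTameGenerator p τ)
    (hII : TypeTwo.IsTypeII σ τ (ρ.comp (TypeTwo.res ι))) :
    (TypeTwo.latticeT' ρ (TypeTwo.teichLift β)⁻¹ (hρ.dvd hrbar.apply_one_zero)).delta ι = 0 ∧
      ((∀ s : TypeTwo.GLoc ℓ, β (TypeTwo.res ι s) = 1) →
        (TypeTwo.latticeT ρ (TypeTwo.teichLift β)⁻¹).delta ι = 1) := by
  exact ⟨TypeTwo.GaloisLattice.delta_eq_zero hℓ.ne _ ι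
    (TypeTwo.H1nr_latticeT'_eq_bot hp hrbar hρ hℓ hσ hτ hII),
    fun hβ => TypeTwo.delta_latticeT_eq_one hrbar hρ hℓ hβ hσ hτ hII⟩
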